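/- **Setting.** Let $T\ge 1$. Let $(\Omega_1,\mathcal F,P_1)$, $(\Omega_2,\mathcal G,P_2)$ be probability spaces and $\mathbb P=P_1\otimes P_2$. Let $\xi_t:\Omega_1\to\mathbb R^{m_{1,t}}$ ($1\le t\le T$) and $\zeta_t:\Omega_2\to\mathbb R^{m_{2,t}}$ ($0\le t\le T$) be random vectors with $\zeta_0,\dots,\zeta_T$ mutually independent; write $\xi_{[t]}=(\xi_1,\dots,\xi_t)$. Given are an initial state $s_0$, a set $\mathcal X_0\subseteq\mathbb R^{n_0}$, real-valued costs $C_0(s_0,x_0,\zeta_0)$ and $C_t(s_t,x_t,\xi_{[t]},\zeta_t)$ ($1\le t\le T$), finitely many real-valued constraint functions $g_{t,i}(s_t,x_t,x_{t-1},\xi_{[t]})$, $i\in I_t$ ($1\le t\le T$), and transitions $s_1=S^M_0(s_0,x_0,\zeta_0)$, $s_{t+1}=S^M_t(s_t,x_t,\xi_t,\zeta_t)$ ($1\le t\le T-1$), all variables ranging over Euclidean spaces. Put $$\mathcal X_t(s_t,x_{t-1},\xi_{[t]})=\{x_t\in\mathbb R^{n_t}: g_{t,i}(s_t,x_t,x_{t-1},\xi_{[t]})\le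 0,\ i\in I_t\}.$$ A *feasible policy* consists of a deterministic $x_0\in\mathcal X_0$ and, for $t=1,\dots,T$, decisions $x_t$ that satisfy $x_t\in\mathcal X_t(s_t,x_{t-1},\xi_{[t]})$ almost surely, where $x_t$ is a measurable function of $(s_t,x_{t-1},\xi_{[t]})$ (feedback policies) or, alternatively, of $(\xi_{[t]},\zeta_0,\dots,\zeta_{t-1})$ (history-dependent policies). The problem (MSP-MDP) is to minimize $$\mathbb E\Big[C_0(s_0,x_0,\zeta_0)+\sum_{t=1}^T C_t(s_t,x_t,\xi_{[t]},\zeta_t)\Big]$$ over the feasible policies of the chosen class. Expectations take values in $[-\infty,+\infty]$ and $\inf\emptyset=+\infty$. **Nested problem and recursion.** For $1\le t\le T-1$ let $\mathbb E_{\xi_{t+1}\mid\xi_{[t]},\zeta_t}$ denote the expectation in which $\xi_{t+1}$ has its regular conditional distribution given $\xi_{[t]}$ and $\zeta_t$ has its own distribution, independently. The nested problem is $$\inf_{x_0\in\mathcal X_0}\mathbb E_{\zeta_0}\Big[C_0+\mathbb E_{\xi_1}\Big[\inf_{x_1\in\mathcal X_1(s_1,x_0,\xi_1)}\mathbb E_{\xi_2\mid\xi_1,\zeta_1}\Big[C_1+\cdots+\inf_{x_T\in\mathcal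 X_T(s_T,x_{T-1},\xi_{[T]})}\mathbb E_{\zeta_T}[C_T]\Big]\cdots\Big]\Big]$$ subject to the transitions. The value functions are, with $s_t=S^M_{t-1}(s_{t-1},x_{t-1},\xi_{t-1},\zeta_{t-1})$ (no $\xi_{t-1}$ if $t=1$), $$v_T(s_{T-1},x_{T-1},\xi_{[T]},\zeta_{T-1})=\inf_{x_T\in\mathcal X_T(s_T,x_{T-1},\xi_{[T]})}\mathbb E_{\zeta_T}[C_T(s_T,x_T,\xi_{[T]},\zeta_T)],$$ $$v_t(s_{t-1},x_{t-1},\xi_{[t]},\zeta_{t-1})=\inf_{x_t\in\mathcal X_t(s_t,x_{t-1},\xi_{[t]})}\mathbb E_{\xi_{t+1}\mid\xi_{[t]},\zeta_t}\big[C_t(s_t,x_t,\xi_{[t]},\zeta_t)+v_{t+1}(s_t,x_t,\xi_{[t+1]},\zeta_t)\big],\quad 1\le t\le T-1,$$ $$v_0(s_0)=\inf_{x_0\in\mathcal X_0}\mathbb E_{\zeta_0}\big[C_0(s_0,x_0,\zeta_0)+\mathbb E_{\xi_1}[v_1(s_0,x_0,\xi_1,\zeta_0)]\big].$$ **Assumptions.**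 (1) For $1\le t\le T$: (a) there is an integrable $h_t(\xi_{[t]},\zeta_t)\ge 0$ such that, almost surely, $C_t(s,x,\xi_{[t]},\zeta_t)\ge -h_t(\xi_{[t]},\zeta_t)$ for all $(s,x)$; (b) for every $(s_t,x_{t-1})$ there is a measurable $\hat x_t(\xi_{[t]})$ with $\hat x_t(\xi_{[t]})\in\mathcal X_t(s_t,x_{t-1},\xi_{[t]})$ almost surely and $\mathbb E[C_t(s_t,\hat x_t(\xi_{[t]}),\xi_{[t]},\zeta_t)]<\infty$. For $t=0$: $C_0(s_0,x_0,\cdot)$ is measurable for each $x_0\in\mathcal X_0$, and there is an integrable $h_0(\zeta_0)\ge 0$ such that, almost surely, $C_0(s_0,x_0,\zeta_0)\ge -h_0(\zeta_0)$ for all $x_0\in\mathcal X_0$. (2) $C_t$ and $g_{t,i}$ ($1\le t\le T$) and $S^M_t$ ($0\le t\le T-1$) are jointly continuous. (3) For $1\le t\le T$ there is a bounded set $\mathcal X^0_t$ such that, almost surely, $\mathcal X_t(s,x,\xi_{[t]})\subseteq\mathcal X_t^0$ for all $(s,x)$. **Theorem (nested reformulation).** Under (1)–(3), for either class of policies: 1.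 Every expectation above is well defined (for almost every $\xi_{[t]}$ in the recursion): the integrand is measurable up to a null set and its negative part is integrable. 2. The optimal value of (MSP-MDP), the optimal value of the nested problem and $v_0(s_0)$ are equal. 3. For $1\le t\le T$ and almost every $\xi_{[t]}$, the infimum defining $v_t(s_{t-1},x_{t-1},\xi_{[t]},\zeta_{t-1})$ is a minimum for all $(s_{t-1},x_{t-1},\zeta_{t-1})$. 4. A feasible policy is optimal for (MSP-MDP) if $x_0$ is a minimizer in the definition of $v_0(s_0)$ and, for $1\le t\le T$, $x_t$ is almost surely a minimizer in the definition of $v_t(s_{t-1},x_{t-1},\xi_{[t]},\zeta_{t-1})$; if $v_0(s_0)<\infty$, every optimal policy has these properties. 5. Every $x_0\in\mathcal X_0$ attaining $v_0(s_0)$ is the initial decision of an optimal policy. If $\mathcal X_0$ is nonempty and compact and $C_0(s_0,\cdot,\zeta_0)$ is continuous on $\mathcal X_0$ for every value of $\zeta_0$, an optimal policy exists. -/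

import Mathlib

open MeasureTheory ProbabilityTheory

noncomputable section

namespace MSPMDP

/-- Euclidean space of dimension `k`. -/
abbrev Vec (k : ℕ) : Type := EuclideanSpace ℝ (Fin k)

/-- Histories `ξ_[t] = (ξ₁, …, ξ_t)`: the coordinate `i : Fin t` is `ξ_{i+1}`.
`ExoHist m 0` is a one-point space. -/
abbrev ExoHist (m : ℕ → ℕ) (t : ℕ) : Type := (i : Fin t) → Vec (m (i + 1))

/-- Histories `(ζ₀, …, ζ_{t-1})`. -/
abbrev EndoHist (m : ℕ → ℕ) (t : ℕ) : Type := (i : Fin t) → Vec (m i)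

/-- Expectation of an extended-real-valued function, `E[f⁺] - E[f⁻]`. It is meaningful when
`f` is `QuasiIntegrable` in the sense below. -/
def expect {α : Type*} [MeasurableSpace α] (μ : Measure α) (f : α → EReal) : EReal :=
  ((∫⁻ a, (f a).toENNReal ∂μ : ENNReal) : EReal) - ((∫⁻ a, (-f a).toENNReal ∂μ : ENNReal) : EReal)

/-- `f` is measurable (up to a null set) and has an integrable negative part, so that its
expectation is a well-defined element of `(-∞, +∞]`. -/
def QuasiIntegrable {α : Type*} [MeasurableSpace α] (μ : Measure α) (f : α → EReal) : Prop :=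
  AEMeasurable f μ ∧ ∫⁻ a, (-f a).toENNReal ∂μ ≠ ⊤

/-- The data of an integrated MSP-MDP problem with stages `0, 1, …, T`. Families are indexed by
all of `ℕ`; only the indices that belong to the stages `0, …, T` matter.

The exogenous process `ξ₁, …, ξ_T` lives on `(Ω₁, P₁)`, the endogenous process `ζ₀, …, ζ_T` on
`(Ω₂, P₂)`, and the problem is posed on the product probability space. -/
structure Model (Ω₁ Ω₂ : Type*) [MeasurableSpace Ω₁] [MeasurableSpace Ω₂] where
  /-- horizon -/
  T : ℕ
  one_le_T : 1 ≤ T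
  /-- dimension of the state `s_t` -/
  dimS : ℕ → ℕ
  /-- dimension of the decision `x_t` -/
  dimX : ℕ → ℕ
  /-- dimension of the exogenous random vector `ξ_t` -/
  dimXi : ℕ → ℕ
  /-- dimension of the endogenous random vector `ζ_t` -/
  dimZ : ℕ → ℕ
  P₁ : Measure Ω₁
  P₂ : Measure Ω₂
  prob₁ : IsProbabilityMeasure P₁
  prob₂ : IsProbabilityMeasure P₂
  /-- the exogenous process; `ξ 0` is not used -/
  ξ : (t : ℕ) → Ω₁ → Vec (dimXi t)
  /-- the endogenous process -/
  ζ : (t : ℕ) → Ω₂ → Vec (dimZ t)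
  measurable_ξ : ∀ t, 1 ≤ t → t ≤ T → Measurable (ξ t)
  measurable_ζ : ∀ t, t ≤ T → Measurable (ζ t)
  /-- `ζ₀, …, ζ_T` are mutually independent -/
  indep_ζ : iIndepFun (fun t : Fin (T + 1) => ζ t) P₂
  /-- initial state -/
  s₀ : Vec (dimS 0)
  /-- feasible set of the initial decision -/
  X₀ : Set (Vec (dimX 0))
  /-- `C t s_t x_t ξ_[t] ζ_t` is the cost of stage `t` -/
  C : (t : ℕ) → Vec (dimS t) → Vec (dimX t) → ExoHist dimXi t → Vec (dimZ t) → ℝ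
  /-- `nCons t` is the number of constraints of stage `t + 1` -/
  nCons : ℕ → ℕ
  /-- `g t i s_{t+1} x_{t+1} x_t ξ_[t+1]` is the `i`-th constraint function of stage `t + 1` -/
  g : (t : ℕ) → Fin (nCons t) → Vec (dimS (t + 1)) → Vec (dimX (t + 1)) → Vec (dimX t) →
    ExoHist dimXi (t + 1) → ℝ
  /-- the first transition `s₁ = S₀ s₀ x₀ ζ₀` -/
  S₀ : Vec (dimS 0) → Vec (dimX 0) → Vec (dimZ 0) → Vec (dimS 1)
  /-- the later transitions `s_{t+2} = S t s_{t+1} x_{t+1} ξ_{t+1} ζ_{t+1}` -/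
  S : (t : ℕ) → Vec (dimS (t + 1)) → Vec (dimX (t + 1)) → Vec (dimXi (t + 1)) →
    Vec (dimZ (t + 1)) → Vec (dimS (t + 2))

attribute [instance] Model.prob₁ Model.prob₂

namespace Model

variable {Ω₁ Ω₂ : Type*} [MeasurableSpace Ω₁] [MeasurableSpace Ω₂] (M : Model Ω₁ Ω₂)

/-- The product probability measure. -/
def P : Measure (Ω₁ × Ω₂) := M.P₁.prod M.P₂

/-- The random history `ξ_[t]`. -/
def exo (t : ℕ) (ω : Ω₁) : ExoHist M.dimXi t := fun i => M.ξ (i + 1) ω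

/-- The random history `(ζ₀, …, ζ_{t-1})`. -/
def endo (t : ℕ) (ω : Ω₂) : EndoHist M.dimZ t := fun i => M.ζ i ω

/-- The law of `ξ_[t]`. -/
def lawExo (t : ℕ) : Measure (ExoHist M.dimXi t) := M.P₁.map (M.exo t)

/-- The law of `ζ_t`. -/
def lawZ (t : ℕ) : Measure (Vec (M.dimZ t)) := M.P₂.map (M.ζ t)

/-- The regular conditional distribution of `ξ_{t+1}` given `ξ_[t]`. -/
def condLaw (t : ℕ) : Kernel (ExoHist M.dimXi t) (Vec (M.dimXi (t + 1))) :=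
  condDistrib (M.ξ (t + 1)) (M.exo t) M.P₁

/-- The trivial history `ξ_[0]`. -/
def hist₀ : ExoHist M.dimXi 0 := fun i => i.elim0

/-- `step t s_t x_t ξ_[t] ζ_t = s_{t+1}`. -/
def step : (t : ℕ) → Vec (M.dimS t) → Vec (M.dimX t) → ExoHist M.dimXi t → Vec (M.dimZ t) →
    Vec (M.dimS (t + 1))
  | 0, s, x, _, z => M.S₀ s x z
  | t + 1, s, x, h, z => M.S t s x (h (Fin.last t)) z

/-- `feas t s_{t+1} x_t ξ_[t+1]` is the feasible set of the decision `x_{t+1}`. -/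
def feas (t : ℕ) (s : Vec (M.dimS (t + 1))) (x : Vec (M.dimX t)) (h : ExoHist M.dimXi (t + 1)) :
    Set (Vec (M.dimX (t + 1))) :=
  {x' | ∀ i, M.g t i s x' x h ≤ 0}

/-! ### The problem over policies -/

/-- A decision process `(x_t)`, as a family of functions of the outcome. -/
abbrev Decision : Type _ := (t : ℕ) → Ω₁ × Ω₂ → Vec (M.dimX t)

/-- The state process generated by a decision process. -/
def state (x : M.Decision) : (t : ℕ) → Ω₁ × Ω₂ → Vec (M.dimS t)
  | 0, _ => M.s₀
  | t + 1, ω => M.step t (state x t ω) (x t ω) (M.exo t ω.1) (M.ζ t ω.2)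

/-- The total cost `∑_{t=0}^T C_t(s_t, x_t, ξ_[t], ζ_t)` along an outcome. -/
def totalCost (x : M.Decision) (ω : Ω₁ × Ω₂) : ℝ :=
  ∑ t ∈ Finset.range (M.T + 1), M.C t (M.state x t ω) (x t ω) (M.exo t ω.1) (M.ζ t ω.2)

/-- The objective: the expected total cost. -/
def cost (x : M.Decision) : EReal := expect M.P fun ω => ((M.totalCost x ω : ℝ) : EReal)

end Model

/-- The two usual classes of policies: `feedback`, where `x_t` is a measurable function of
`(s_t, x_{t-1}, ξ_[t])`, and `history`, where `x_t` is a measurable function of everything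
observed, `(ξ_[t], ζ₀, …, ζ_{t-1})`. -/
inductive PolicyClass
  | feedback
  | history

namespace Model

variable {Ω₁ Ω₂ : Type*} [MeasurableSpace Ω₁] [MeasurableSpace Ω₂] (M : Model Ω₁ Ω₂)

/-- The information constraint on the decisions `x₁, …, x_T`. -/
def Implementable : PolicyClass → M.Decision → Prop
  | .feedback, x => ∀ t, t < M.T →
      ∃ π : Vec (M.dimS (t + 1)) × Vec (M.dimX t) × ExoHist M.dimXi (t + 1) →
          Vec (M.dimX (t + 1)),
        Measurable π ∧ ∀ ω, x (t + 1) ω = π (M.state x (t + 1) ω, x t ω, M.exo (t + 1) ω.1)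
  | .history, x => ∀ t, t < M.T →
      ∃ π : ExoHist M.dimXi (t + 1) × EndoHist M.dimZ (t + 1) → Vec (M.dimX (t + 1)),
        Measurable π ∧ ∀ ω, x (t + 1) ω = π (M.exo (t + 1) ω.1, M.endo (t + 1) ω.2)

/-- Feasible policies of the class `c`: the initial decision is deterministic and lies in `X₀`,
and the constraints of the stages `1, …, T` hold almost surely. -/
def Feasible (c : PolicyClass) (x : M.Decision) : Prop :=
  (∃ x₀ ∈ M.X₀, ∀ ω, x 0 ω = x₀) ∧ M.Implementable c x ∧
    ∀ t, t < M.T → ∀ᵐ ω ∂M.P,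
      x (t + 1) ω ∈ M.feas t (M.state x (t + 1) ω) (x t ω) (M.exo (t + 1) ω.1)

/-- Optimal value of the problem over policies. -/
def optValue (c : PolicyClass) : EReal := ⨅ (x : M.Decision) (_ : M.Feasible c x), M.cost x

/-- Optimal policies. -/
def IsOptimal (c : PolicyClass) (x : M.Decision) : Prop :=
  M.Feasible c x ∧ ∀ y, M.Feasible c y → M.cost x ≤ M.cost y

/-! ### The nested problem -/

/-- The part of the nested problem from stage `t + 1` on, with `k` further stages after it, as a
function of `s_{t+1}`, `x_t` and `ξ_[t+1]`. -/
def nestedTail : (k t : ℕ) → Vec (M.dimS (t + 1)) → Vec (M.dimX t) → ExoHist M.dimXi (t + 1) →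
    EReal
  | 0, t, s, x, h =>
      ⨅ x' ∈ M.feas t s x h,
        expect (M.lawZ (t + 1)) fun z => ((M.C (t + 1) s x' h z : ℝ) : EReal)
  | k + 1, t, s, x, h =>
      ⨅ x' ∈ M.feas t s x h,
        expect ((M.condLaw (t + 1) h).prod (M.lawZ (t + 1))) fun p =>
          ((M.C (t + 1) s x' h p.2 : ℝ) : EReal) +
            nestedTail k (t + 1) (M.step (t + 1) s x' h p.2) x' (Fin.snoc h p.1)

/-- Optimal value of the nested problem. -/
def nestedValue : EReal :=
  ⨅ x ∈ M.X₀, expect (M.lawZ 0) fun z =>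
    ((M.C 0 M.s₀ x M.hist₀ z : ℝ) : EReal) +
      expect (M.lawExo 1) fun y => M.nestedTail (M.T - 1) 0 (M.step 0 M.s₀ x M.hist₀ z) x y

/-! ### The backward recursion -/

/-- `E_{ζ_t}[C_t(s, x, h, ζ_t)]`, the objective of the last stage `t = T`. -/
def lastObj (t : ℕ) (s : Vec (M.dimS t)) (x : Vec (M.dimX t)) (h : ExoHist M.dimXi t) : EReal :=
  expect (M.lawZ t) fun z => ((M.C t s x h z : ℝ) : EReal)

/-- `E[C_t(s, x, h, ζ_t) + w(s, x, (h, ξ_{t+1}), ζ_t)]`, where `ξ_{t+1}` has its conditional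
distribution given `ξ_[t] = h` and `ζ_t` is independent of it. -/
def bellmanObj (t : ℕ)
    (w : Vec (M.dimS t) → Vec (M.dimX t) → ExoHist M.dimXi (t + 1) → Vec (M.dimZ t) → EReal)
    (s : Vec (M.dimS t)) (x : Vec (M.dimX t)) (h : ExoHist M.dimXi t) : EReal :=
  expect ((M.condLaw t h).prod (M.lawZ t)) fun p =>
    ((M.C t s x h p.2 : ℝ) : EReal) + w s x (Fin.snoc h p.1) p.2

/-- The backward recursion, `k` being the number of stages after stage `t + 1`. -/
def valueAux : (k t : ℕ) → Vec (M.dimS t) → Vec (M.dimX t) → ExoHist M.dimXi (t + 1) →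
    Vec (M.dimZ t) → EReal
  | 0, t, s, x, h, z =>
      ⨅ x' ∈ M.feas t (M.step t s x (Fin.init h) z) x h,
        M.lastObj (t + 1) (M.step t s x (Fin.init h) z) x' h
  | k + 1, t, s, x, h, z =>
      ⨅ x' ∈ M.feas t (M.step t s x (Fin.init h) z) x h,
        M.bellmanObj (t + 1) (valueAux k (t + 1)) (M.step t s x (Fin.init h) z) x' h

/-- `M.value t s_t x_t ξ_[t+1] ζ_t` is the value function `v_{t+1}`, for `t = 0, …, T - 1`. -/
def value (t : ℕ) : Vec (M.dimS t) → Vec (M.dimX t) → ExoHist M.dimXi (t + 1) →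
    Vec (M.dimZ t) → EReal :=
  M.valueAux (M.T - (t + 1)) t

/-- `M.stageObj t s_t x_t ξ_[t]` is the function of `x_t` that is minimized at stage `t`, for
`t = 1, …, T`. -/
def stageObj (t : ℕ) (s : Vec (M.dimS t)) (x : Vec (M.dimX t)) (h : ExoHist M.dimXi t) : EReal :=
  if t < M.T then M.bellmanObj t (M.value t) s x h else M.lastObj t s x h

/-- The function of `x₀` that is minimized at stage `0`. -/
def initObj (x : Vec (M.dimX 0)) : EReal :=
  expect (M.lawZ 0) fun z =>
    ((M.C 0 M.s₀ x M.hist₀ z : ℝ) : EReal) + expect (M.lawExo 1) fun y => M.value 0 M.s₀ x y z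

/-- The value `v₀(s₀)`. -/
def v₀ : EReal := ⨅ x ∈ M.X₀, M.initObj x

/-- The recursion in the usual form. -/
theorem value_eq (t : ℕ) (ht : t < M.T) (s : Vec (M.dimS t)) (x : Vec (M.dimX t))
    (h : ExoHist M.dimXi (t + 1)) (z : Vec (M.dimZ t)) :
    M.value t s x h z =
      ⨅ x' ∈ M.feas t (M.step t s x (Fin.init h) z) x h,
        M.stageObj (t + 1) (M.step t s x (Fin.init h) z) x' h := by
  unfold value stageObj
  by_cases h' : t + 1 < M.T
  · obtain ⟨k, hk⟩ : ∃ k, M.T - (t + 1) = k + 1 := ⟨M.T - (t + 1) - 1, by omega⟩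
    have hk' : M.T - (t + 1 + 1) = k := by omega
    simp only [h', if_true, hk, valueAux]
    unfold value
    rw [hk']
  · have hk : M.T - (t + 1) = 0 := by omega
    simp only [h', if_false, hk, valueAux]

/-- A policy whose decisions solve the stagewise problems along (almost) every outcome. -/
def StagewiseOptimal (x : M.Decision) : Prop :=
  (∀ ω, M.initObj (x 0 ω) = M.v₀) ∧
    ∀ t, t < M.T → ∀ᵐ ω ∂M.P,
      M.stageObj (t + 1) (M.state x (t + 1) ω) (x (t + 1) ω) (M.exo (t + 1) ω.1) =
        M.value t (M.state x t ω) (x t ω) (M.exo (t + 1) ω.1) (M.ζ t ω.2)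

/-- Every expectation in the recursion and in the problem over policies is well defined. -/
structure WellPosed (c : PolicyClass) : Prop where
  policy : ∀ x, M.Feasible c x →
    QuasiIntegrable M.P fun ω => ((M.totalCost x ω : ℝ) : EReal)
  init_inner : ∀ x ∈ M.X₀, ∀ z, QuasiIntegrable (M.lawExo 1) fun y => M.value 0 M.s₀ x y z
  init_outer : ∀ x ∈ M.X₀, QuasiIntegrable (M.lawZ 0) fun z =>
    ((M.C 0 M.s₀ x M.hist₀ z : ℝ) : EReal) + expect (M.lawExo 1) fun y => M.value 0 M.s₀ x y z
  middle : ∀ t, 1 ≤ t → t < M.T → ∀ᵐ h ∂M.lawExo t, ∀ s x,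
    QuasiIntegrable ((M.condLaw t h).prod (M.lawZ t)) fun p =>
      ((M.C t s x h p.2 : ℝ) : EReal) + M.value t s x (Fin.snoc h p.1) p.2
  last : ∀ᵐ h ∂M.lawExo M.T, ∀ s x,
    QuasiIntegrable (M.lawZ M.T) fun z => ((M.C M.T s x h z : ℝ) : EReal)

/-! ### Assumptions -/

/-- Integrable cost functions, stages `1, …, T`. -/
structure IntegrableCosts : Prop where
  lower : ∀ t, 1 ≤ t → t ≤ M.T → ∃ b : ExoHist M.dimXi t × Vec (M.dimZ t) → ℝ,
    (∀ p, 0 ≤ b p) ∧ Integrable b ((M.lawExo t).prod (M.lawZ t)) ∧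
      ∀ᵐ p ∂(M.lawExo t).prod (M.lawZ t), ∀ s x, -b p ≤ M.C t s x p.1 p.2
  finite : ∀ t, t < M.T → ∀ (s : Vec (M.dimS (t + 1))) (x : Vec (M.dimX t)),
    ∃ x' : ExoHist M.dimXi (t + 1) → Vec (M.dimX (t + 1)), Measurable x' ∧
      (∀ᵐ h ∂M.lawExo (t + 1), x' h ∈ M.feas t s x h) ∧
      expect ((M.lawExo (t + 1)).prod (M.lawZ (t + 1)))
        (fun p => ((M.C (t + 1) s (x' p.1) p.1 p.2 : ℝ) : EReal)) < ⊤

/-- Stage `0`: the cost of every admissible initial decision is measurable in `ζ₀` and there is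
an integrable lower bound. -/
structure InitialCost : Prop where
  meas : ∀ x ∈ M.X₀, Measurable fun z => M.C 0 M.s₀ x M.hist₀ z
  lower : ∃ b : Vec (M.dimZ 0) → ℝ, (∀ z, 0 ≤ b z) ∧ Integrable b (M.lawZ 0) ∧
    ∀ᵐ z ∂M.lawZ 0, ∀ x ∈ M.X₀, -b z ≤ M.C 0 M.s₀ x M.hist₀ z

/-- Continuity of the costs, constraint functions and transition maps. -/
structure ContinuousData : Prop where
  cost : ∀ t, 1 ≤ t → t ≤ M.T →
    Continuous fun p : Vec (M.dimS t) × Vec (M.dimX t) × ExoHist M.dimXi t × Vec (M.dimZ t) =>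
      M.C t p.1 p.2.1 p.2.2.1 p.2.2.2
  constraint : ∀ t, t < M.T → ∀ i,
    Continuous fun p : Vec (M.dimS (t + 1)) × Vec (M.dimX (t + 1)) × Vec (M.dimX t) ×
        ExoHist M.dimXi (t + 1) =>
      M.g t i p.1 p.2.1 p.2.2.1 p.2.2.2
  trans₀ : Continuous fun p : Vec (M.dimS 0) × Vec (M.dimX 0) × Vec (M.dimZ 0) =>
    M.S₀ p.1 p.2.1 p.2.2
  trans : ∀ t, t + 1 < M.T →
    Continuous fun p : Vec (M.dimS (t + 1)) × Vec (M.dimX (t + 1)) × Vec (M.dimXi (t + 1)) ×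
        Vec (M.dimZ (t + 1)) =>
      M.S t p.1 p.2.1 p.2.2.1 p.2.2.2

/-- Uniform boundedness of the feasible sets of the stages `1, …, T`. -/
def BoundedFeasibleSets : Prop :=
  ∀ t, t < M.T → ∃ B : Set (Vec (M.dimX (t + 1))), Bornology.IsBounded B ∧
    ∀ᵐ h ∂M.lawExo (t + 1), ∀ s x, M.feas t s x h ⊆ B

end Model

end MSPMDP

end

open MeasureTheory ProbabilityTheory
open scoped ENNReal NNReal Topology

namespace MSPMDP

/-! ### Expectations of extended-real-valued functions -/

/-! The theorem is a dynamic programming principle, and the analytic difficulty is to keep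
measurability and attainment through the backward recursion.

Two reductions make the recursion tractable. Adding integrable bounds `B t` to the costs makes
everything `[0, ∞]`-valued; each original quantity is the shifted one minus a finite slack that no
decision influences, so minimizers and comparisons are unchanged (`expect_of_ae_eq_sub`). An
infinite penalty encodes the constraints, so that the random feasible sets are replaced by fixed
closed balls.

The shifted recursion stays in the class of normal integrands, the increasing limits of bounded
functions continuous in state and decision and measurable in the history. Integration against a
kernel preserves the class by dominated and monotone convergence (`NormalIntegrand.lintegral`), so
the conditional laws need only be measurable in the history. Minimization over a compact set
preserves it because suprema of increasing sequences commute with such minima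
(`iSup_biInf_eq_biInf_iSup`). Hence minima are attained, and a lexicographic choice selects them
measurably. Backward induction transfers this to the original recursion outside a null set of
histories that does not depend on state or decision (`ae_regular`).

For the comparison of policies, the process `(s_t, x_t)` is a function of `(ξ_[t], ζ₀, …, ζ_{t-1})`
in both classes. Independence and disintegration then show that the expected objective of a stage is
the expected stage cost plus the expected later value (`lintegral_pathObj_succ`). Feasible decisions
satisfy value ≤ objective almost surely, so telescoping bounds the cost of every policy below by its
initial objective, with equality for stagewise minimizers. If the value is finite, equal integrals
force almost sure equality at every stage (`ae_eq_of_lintegral_pathVal_eq`). Measurable minimizers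
form a feedback law, which is implementable in both classes, so the bound is attained from every
admissible `x₀`. -/

theorem EReal_sub_eq_sub_of_add_eq_add {p q a b : ℝ≥0∞} (hq : q ≠ ⊤) (hb : b ≠ ⊤)
    (h : p + b = q + a) : (p : EReal) - (q : EReal) = (a : EReal) - (b : EReal) := by
  lift q to ℝ≥0 using hq
  lift b to ℝ≥0 using hb
  induction p with
  | top =>
    have : a = ⊤ := by
      by_contra ha
      exact (ENNReal.add_ne_top.2 ⟨ENNReal.coe_ne_top, ha⟩) (by rw [← h]; simp)
    subst this
    rw [EReal.coe_ennreal_top, EReal.top_sub (by simp), EReal.top_sub (by simp)]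
  | coe p =>
    have ha : a ≠ ⊤ := by
      rintro rfl
      rw [add_top] at h
      exact ENNReal.add_ne_top.2 ⟨ENNReal.coe_ne_top, ENNReal.coe_ne_top⟩ h
    lift a to ℝ≥0 using ha
    have h' : (p : ℝ) + b = q + a := by exact_mod_cast h
    simp only [EReal.coe_nnreal_eq_coe_real]
    rw [← EReal.coe_sub, ← EReal.coe_sub]
    congr 1
    linarith

theorem EReal_sub_right_inj {a b c : ℝ≥0∞} (hc : c ≠ ⊤) :
    (a : EReal) - (c : EReal) = (b : EReal) - (c : EReal) ↔ a = b := by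
  refine ⟨fun h => ?_, fun h => by rw [h]⟩
  lift c to ℝ≥0 using hc
  have h' := congrArg (fun e : EReal => e + ((c : ℝ) : EReal)) h
  simp only [EReal.coe_nnreal_eq_coe_real, EReal.sub_add_cancel] at h'
  have h2 := congrArg EReal.toENNReal h'
  simpa using h2

theorem EReal_sub_le_sub_right_iff {a b c : ℝ≥0∞} (hc : c ≠ ⊤) :
    (a : EReal) - (c : EReal) ≤ (b : EReal) - (c : EReal) ↔ a ≤ b := by
  refine ⟨fun h => ?_, fun h => EReal.sub_le_sub (by exact_mod_cast h) le_rfl⟩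
  by_contra! hlt
  have := le_antisymm h (EReal.sub_le_sub (by exact_mod_cast hlt.le) le_rfl)
  exact hlt.ne' ((EReal_sub_right_inj hc).1 this)

theorem EReal_sub_lt_top_iff {a c : ℝ≥0∞} (hc : c ≠ ⊤) :
    (a : EReal) - (c : EReal) < ⊤ ↔ a ≠ ⊤ := by
  rw [lt_top_iff_ne_top, not_iff_not]
  have h : ((⊤ : ℝ≥0∞) : EReal) - (c : EReal) = ⊤ := by
    rw [EReal.coe_ennreal_top, EReal.top_sub (by simpa using hc)]
  conv_lhs => rw [← h]
  exact EReal_sub_right_inj hc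

theorem EReal_sub_add_sub {a b c d : ℝ≥0∞} :
    ((a : EReal) - c) + ((b : EReal) - d) =
      ((a + b : ℝ≥0∞) : EReal) - ((c + d : ℝ≥0∞) : EReal) := by
  rw [EReal.coe_ennreal_add, EReal.coe_ennreal_add, EReal.add_sub_add_comm] <;> simp

/-- In truncated subtraction the positive and negative parts of `f` are `F - H` and `H - F`, and `(F
- H) + H = max F H = (H - F) + F`. Integrating and cancelling the finite integrals gives the
formula. -/
theorem expect_of_ae_eq_sub {α : Type*} [MeasurableSpace α] {μ : Measure α} {f : α → EReal}
    {F H : α → ℝ≥0∞} (hF : AEMeasurable F μ) (hH : AEMeasurable H μ) (hfin : ∫⁻ a, H a ∂μ ≠ ⊤)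
    (h : ∀ᵐ a ∂μ, f a = (F a : EReal) - (H a : EReal)) :
    QuasiIntegrable μ f ∧
      expect μ f = ((∫⁻ a, F a ∂μ : ℝ≥0∞) : EReal) - ((∫⁻ a, H a ∂μ : ℝ≥0∞) : EReal) := by
  have hlt : ∀ᵐ a ∂μ, H a < ⊤ := ae_lt_top' hH hfin
  have h1 : ∫⁻ a, (f a).toENNReal ∂μ = ∫⁻ a, F a - H a ∂μ := by
    refine lintegral_congr_ae ?_
    filter_upwards [h] with a ha
    rw [ha, EReal.toENNReal_sub (EReal.coe_ennreal_nonneg _)]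
    simp
  have h2 : ∫⁻ a, (-f a).toENNReal ∂μ = ∫⁻ a, H a - F a ∂μ := by
    refine lintegral_congr_ae ?_
    filter_upwards [h, hlt] with a ha hl
    rw [ha, EReal.neg_sub (by simp) (by right; simpa using hl.ne), add_comm, ← sub_eq_add_neg,
      EReal.toENNReal_sub (EReal.coe_ennreal_nonneg _)]
    simp
  have h3 : ∫⁻ a, H a - F a ∂μ ≠ ⊤ :=
    ne_top_of_le_ne_top hfin (lintegral_mono fun a => tsub_le_self)
  refine ⟨⟨?_, by rwa [h2]⟩, ?_⟩
  · refine AEMeasurable.congr (f := fun a => (F a : EReal) - (H a : EReal)) ?_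
      (by filter_upwards [h] with a ha using ha.symm)
    simp only [sub_eq_add_neg]
    exact hF.coe_ereal_ennreal.add hH.coe_ereal_ennreal.neg
  · unfold expect
    rw [h1, h2]
    refine EReal_sub_eq_sub_of_add_eq_add h3 hfin ?_
    rw [← lintegral_add_right' _ hH, ← lintegral_add_right' _ hF]
    refine lintegral_congr fun a => ?_
    rcases le_total (F a) (H a) with hle | hle
    · rw [tsub_eq_zero_of_le hle, zero_add, tsub_add_cancel_of_le hle]
    · rw [tsub_eq_zero_of_le hle, zero_add, tsub_add_cancel_of_le hle]

/-! ### Infima of continuous functions over compact sets -/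

/-- With `c` the supremum of the minima, the sets `K ∩ {F n ≤ c}` are compact, decreasing and
nonempty, since each contains a minimizer of `F n`. A common point satisfies `⨆ n, F n x ≤ c` and
therefore minimizes the supremum. -/
theorem iSup_biInf_eq_biInf_iSup {X : Type*} [TopologicalSpace X] [T2Space X] {K : Set X}
    (hK : IsCompact K) {F : ℕ → X → ℝ≥0∞} (hF : ∀ n, Continuous (F n))
    (hmono : ∀ x, Monotone fun n => F n x) (hne : K.Nonempty) :
    (⨆ n, ⨅ x ∈ K, F n x = ⨅ x ∈ K, ⨆ n, F n x) ∧
      ∃ x ∈ K, ⨆ n, F n x = ⨅ x ∈ K, ⨆ n, F n x := by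
  set c := ⨆ n, ⨅ x ∈ K, F n x with hc
  have hle : c ≤ ⨅ x ∈ K, ⨆ n, F n x :=
    iSup_le fun n => le_iInf₂ fun x hx => (iInf₂_le x hx).trans (le_iSup (fun n => F n x) n)
  have hcl : ∀ n, IsClosed (K ∩ {x | F n x ≤ c}) := fun n =>
    hK.isClosed.inter (isClosed_le (hF n) continuous_const)
  obtain ⟨x, hx⟩ := IsCompact.nonempty_iInter_of_sequence_nonempty_isCompact_isClosed
    (fun n => K ∩ {x | F n x ≤ c})
    (fun n x hx => ⟨hx.1, (hmono x (Nat.le_succ n)).trans hx.2⟩)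
    (fun n => by
      obtain ⟨x, hxK, hx⟩ := hK.exists_isMinOn hne (hF n).continuousOn
      refine ⟨x, hxK, ?_⟩
      refine le_trans (le_iInf₂ fun y hy => hx hy) (le_iSup (fun n => ⨅ x ∈ K, F n x) n))
    (hK.inter_right (isClosed_le (hF 0) continuous_const)) hcl
  rw [Set.mem_iInter] at hx
  have hxK : x ∈ K := (hx 0).1
  have h2 : ⨆ n, F n x ≤ c := iSup_le fun n => (hx n).2
  have h3 : ⨅ x ∈ K, ⨆ n, F n x ≤ ⨆ n, F n x := iInf₂_le x hxK
  exact ⟨le_antisymm hle (h3.trans h2), x, hxK, le_antisymm (h2.trans hle) h3⟩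

/-- By continuity a countable dense subset of `K` yields the same infimum. -/
theorem measurable_biInf_of_continuous {α X : Type*} [MeasurableSpace α] [TopologicalSpace X]
    [TopologicalSpace.MetrizableSpace X] [SecondCountableTopology X] (K : Set X) {F : X → α → ℝ≥0∞}
    (hc : ∀ a, Continuous fun x => F x a) (hm : ∀ x, Measurable (F x)) :
    Measurable fun a => ⨅ x ∈ K, F x a := by
  obtain ⟨s, hsK, hsc, hs⟩ :=
    (TopologicalSpace.IsSeparable.of_separableSpace K).exists_countable_dense_subset
  have : (fun a => ⨅ x ∈ K, F x a) = fun a => ⨅ x ∈ s, F x a := by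
    funext a
    refine le_antisymm (le_iInf₂ fun x hx => iInf₂_le x (hsK hx)) (le_iInf₂ fun x hx => ?_)
    have hcl : IsClosed {x | ⨅ y ∈ s, F y a ≤ F x a} := isClosed_le continuous_const (hc a)
    exact closure_minimal (fun y hy => iInf₂_le (f := fun y (_ : y ∈ s) => F y a) y hy) hcl (hs hx)
  rw [this]
  exact Measurable.biInf s hsc fun x _ => hm x

/-! ### Normal integrands -/

/-- A function `f u h`, thought of as a family of functions of `u` depending on a parameter `h`, is
a normal integrand if it is the supremum of an increasing sequence of bounded Carathéodory
functions, i.e. of functions that are continuous in `u` and measurable in `h`. -/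
def NormalIntegrand {U H : Type*} [TopologicalSpace U] [MeasurableSpace H]
    (f : U → H → ℝ≥0∞) : Prop :=
  ∃ F : ℕ → U → H → ℝ≥0∞, (∀ n h, Continuous fun u => F n u h) ∧ (∀ n u, Measurable (F n u)) ∧
    (∀ n, ∃ c : ℝ≥0, ∀ u h, F n u h ≤ c) ∧ (∀ u h, Monotone fun n => F n u h) ∧
    ∀ u h, f u h = ⨆ n, F n u h

namespace NormalIntegrand

variable {U X H H' Z : Type*} [TopologicalSpace U] [TopologicalSpace X] [MeasurableSpace H]
  [MeasurableSpace H'] [MeasurableSpace Z]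

theorem of_continuous_measurable {f : U → H → ℝ≥0∞} (hc : ∀ h, Continuous fun u => f u h)
    (hm : ∀ u, Measurable (f u)) : NormalIntegrand f := by
  refine ⟨fun n u h => min (f u h) n, fun n h => (hc h).min continuous_const,
    fun n u => (hm u).min measurable_const, fun n => ⟨n, fun u h => by simp⟩,
    fun u h n m hnm => min_le_min le_rfl (by exact_mod_cast hnm), fun u h => ?_⟩
  refine le_antisymm ?_ (iSup_le fun n => min_le_left _ _)
  refine le_of_forall_lt fun c hcl => ?_
  obtain ⟨n, hn⟩ := ENNReal.exists_nat_gt (ne_top_of_lt hcl)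
  exact lt_of_lt_of_le (lt_min hcl hn) (le_iSup (fun n : ℕ => min (f u h) n) n)

theorem add {f g : U → H → ℝ≥0∞} (hf : NormalIntegrand f) (hg : NormalIntegrand g) :
    NormalIntegrand fun u h => f u h + g u h := by
  obtain ⟨F, F1, F2, F3, F4, F5⟩ := hf
  obtain ⟨G, G1, G2, G3, G4, G5⟩ := hg
  refine ⟨fun n u h => F n u h + G n u h, fun n h => (F1 n h).add (G1 n h),
    fun n u => (F2 n u).add (G2 n u), fun n => ?_,
    fun u h n m hnm => add_le_add (F4 u h hnm) (G4 u h hnm), fun u h => ?_⟩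
  · obtain ⟨c, hc⟩ := F3 n
    obtain ⟨d, hd⟩ := G3 n
    exact ⟨c + d, fun u h => by rw [ENNReal.coe_add]; exact add_le_add (hc u h) (hd u h)⟩
  · simp only [F5, G5]
    rw [ENNReal.iSup_add_iSup_of_monotone (F4 u h) (G4 u h)]

/-- Truncating the `n`-th function at level `n` restores boundedness without changing the supremum.
-/
theorem iSup_of_monotone {f : ℕ → U → H → ℝ≥0∞} (hc : ∀ n h, Continuous fun u => f n u h)
    (hm : ∀ n u, Measurable (f n u)) (hmono : ∀ u h, Monotone fun n => f n u h) :
    NormalIntegrand fun u h => ⨆ n, f n u h := by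
  refine ⟨fun n u h => min (f n u h) n, fun n h => (hc n h).min continuous_const,
    fun n u => (hm n u).min measurable_const, fun n => ⟨n, fun u h => by simp⟩,
    fun u h n m hnm => min_le_min (hmono u h hnm) (by exact_mod_cast hnm), fun u h => ?_⟩
  refine le_antisymm ?_ (iSup_mono fun n => min_le_left _ _)
  refine le_of_forall_lt fun c hcl => ?_
  obtain ⟨m, hm⟩ := lt_iSup_iff.1 hcl
  obtain ⟨n, hn⟩ := ENNReal.exists_nat_gt (ne_top_of_lt hcl)
  refine lt_of_lt_of_le (lt_min (hm.trans_le (hmono u h (le_max_left m n)))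
    (hn.trans_le (by exact_mod_cast le_max_right m n)))
    (le_iSup (fun n : ℕ => min (f n u h) n) (max m n))

theorem lowerSemicontinuous {f : U → H → ℝ≥0∞} (hf : NormalIntegrand f) (h : H) :
    LowerSemicontinuous fun u => f u h := by
  obtain ⟨F, F1, F2, F3, F4, F5⟩ := hf
  simp only [F5]
  exact lowerSemicontinuous_iSup fun n => (F1 n h).lowerSemicontinuous

theorem measurable [TopologicalSpace.MetrizableSpace U] [SecondCountableTopology U]
    [MeasurableSpace U] [OpensMeasurableSpace U] {f : U → H → ℝ≥0∞} (hf : NormalIntegrand f) :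
    Measurable fun p : U × H => f p.1 p.2 := by
  obtain ⟨F, F1, F2, F3, F4, F5⟩ := hf
  simp only [F5]
  exact Measurable.iSup fun n => measurable_uncurry_of_continuous_of_measurable (F1 n) (F2 n)

/-- The inner map may depend on the parameter because Carathéodory functions are jointly measurable.
-/
theorem comp [TopologicalSpace.MetrizableSpace X] [SecondCountableTopology X]
    [MeasurableSpace X] [OpensMeasurableSpace X] {f : X → H → ℝ≥0∞} (hf : NormalIntegrand f)
    {φ : U → H' → X} {ψ : H' → H} (hc : ∀ h, Continuous fun u => φ u h)
    (hm : ∀ u, Measurable (φ u)) (hψ : Measurable ψ) :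
    NormalIntegrand fun u h => f (φ u h) (ψ h) := by
  obtain ⟨F, F1, F2, F3, F4, F5⟩ := hf
  refine ⟨fun n u h => F n (φ u h) (ψ h), fun n h => (F1 n (ψ h)).comp (hc h),
    fun n u => (measurable_uncurry_of_continuous_of_measurable (F1 n) (F2 n)).comp
      ((hm u).prodMk hψ), fun n => ?_, fun u h => F4 _ _, fun u h => F5 _ _⟩
  obtain ⟨c, hc⟩ := F3 n
  exact ⟨c, fun u h => hc _ _⟩

/-- Boundedness of the approximants gives continuity of their integrals by dominated convergence,
and monotone convergence identifies the limit. The kernel needs no continuity in `h`. -/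
theorem lintegral [FirstCountableTopology U] {f : U → H × Z → ℝ≥0∞} (hf : NormalIntegrand f)
    (κ : Kernel H Z) [IsFiniteKernel κ] :
    NormalIntegrand fun u h => ∫⁻ z, f u (h, z) ∂κ h := by
  obtain ⟨F, F1, F2, F3, F4, F5⟩ := hf
  have hmeas : ∀ n u h, Measurable fun z => F n u (h, z) := fun n u h =>
    (F2 n u).comp measurable_prodMk_left
  refine ⟨fun n u h => ∫⁻ z, F n u (h, z) ∂κ h, fun n h => ?_,
    fun n u => (F2 n u).lintegral_kernel_prod_right', fun n => ?_,
    fun u h n m hnm => lintegral_mono fun z => F4 u (h, z) hnm, fun u h => ?_⟩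
  · obtain ⟨c, hc⟩ := F3 n
    refine continuous_iff_continuousAt.2 fun u => ?_
    refine tendsto_lintegral_filter_of_dominated_convergence (fun _ => (c : ℝ≥0∞))
      (Filter.Eventually.of_forall fun v => hmeas n v h)
      (Filter.Eventually.of_forall fun v => Filter.Eventually.of_forall fun z => hc v (h, z))
      (by simpa using ENNReal.mul_ne_top ENNReal.coe_ne_top (measure_ne_top (κ h) Set.univ))
      (Filter.Eventually.of_forall fun z => (F1 n (h, z)).continuousAt)
  · obtain ⟨c, hc⟩ := F3 n
    refine ⟨c * κ.bound.toNNReal, fun u h => ?_⟩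
    calc ∫⁻ z, F n u (h, z) ∂κ h ≤ ∫⁻ _, (c : ℝ≥0∞) ∂κ h := lintegral_mono fun z => hc u (h, z)
      _ = c * κ h Set.univ := lintegral_const _
      _ ≤ _ := by
        rw [ENNReal.coe_mul, ENNReal.coe_toNNReal κ.bound_ne_top]
        exact mul_le_mul_right (κ.measure_le_bound h _) _
  · simp only [F5]
    exact lintegral_iSup (fun n => hmeas n u h) fun n m hnm z => F4 u (h, z) hnm

theorem exists_eq_biInf [T2Space X] {f : U × X → H → ℝ≥0∞} (hf : NormalIntegrand f) {K : Set X}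
    (hK : IsCompact K) (hne : K.Nonempty) (u : U) (h : H) :
    ∃ x ∈ K, f (u, x) h = ⨅ x ∈ K, f (u, x) h := by
  obtain ⟨F, F1, F2, F3, F4, F5⟩ := hf
  simp only [F5]
  exact (iSup_biInf_eq_biInf_iSup hK (fun n => (F1 n h).comp (Continuous.prodMk_right u))
    (fun x => F4 (u, x) h) hne).2

/-- Minimizing a jointly continuous approximant over a compact set leaves a continuous function of
`u`; the interchange of supremum and minimum then recovers `f`. -/
theorem biInf [TopologicalSpace.MetrizableSpace X] [SecondCountableTopology X]
    {f : U × X → H → ℝ≥0∞} (hf : NormalIntegrand f) {K : Set X} (hK : IsCompact K) (hne : K.Nonempty) :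
    NormalIntegrand fun u h => ⨅ x ∈ K, f (u, x) h := by
  obtain ⟨F, F1, F2, F3, F4, F5⟩ := hf
  refine ⟨fun n u h => ⨅ x ∈ K, F n (u, x) h, fun n h => ?_, fun n u => ?_, fun n => ?_,
    fun u h n m hnm => iInf₂_mono fun x _ => F4 (u, x) h hnm, fun u h => ?_⟩
  · have := hK.continuous_sInf (f := fun u x => F n (u, x) h) (by exact F1 n h)
    simpa only [sInf_image] using this
  · exact measurable_biInf_of_continuous K
      (fun h => (F1 n h).comp (Continuous.prodMk_right u)) fun x => F2 n (u, x)
  · obtain ⟨c, hc⟩ := F3 n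
    obtain ⟨x, hx⟩ := hne
    exact ⟨c, fun u h => (iInf₂_le x hx).trans (hc _ _)⟩
  · simp only [F5]
    exact ((iSup_biInf_eq_biInf_iSup hK (fun n => (F1 n h).comp (Continuous.prodMk_right u))
      (fun x => F4 (u, x) h) hne).1).symm

end NormalIntegrand

/-! ### Measurable selection -/

/-- A family of nonempty compact sets that depends measurably on a parameter. -/
structure MeasurableCompactValued {α X : Type*} [MeasurableSpace α] [TopologicalSpace X]
    (A : α → Set X) : Prop where
  isCompact : ∀ a, IsCompact (A a)
  nonempty : ∀ a, (A a).Nonempty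
  measurableSet : ∀ D, IsClosed D → MeasurableSet {a | (A a ∩ D).Nonempty}

namespace MeasurableCompactValued

variable {α X : Type*} [MeasurableSpace α] [TopologicalSpace X] {A : α → Set X}

theorem sInf_le_iff (hA : MeasurableCompactValued A) {φ : X → ℝ} (hφ : Continuous φ) (a : α)
    (c : ℝ) : sInf (φ '' A a) ≤ c ↔ (A a ∩ {x | φ x ≤ c}).Nonempty := by
  have hcomp := (hA.isCompact a).image hφ
  constructor
  · intro h
    obtain ⟨x, hx, hxe⟩ := hcomp.sInf_mem ((hA.nonempty a).image φ)
    exact ⟨x, hx, by rw [Set.mem_ofPred_eq, hxe]; exact h⟩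
  · rintro ⟨x, hx, hxc⟩
    exact (csInf_le hcomp.bddBelow ⟨x, hx, rfl⟩).trans hxc

theorem measurable_sInf (hA : MeasurableCompactValued A) {φ : X → ℝ} (hφ : Continuous φ) :
    Measurable fun a => sInf (φ '' A a) := by
  refine measurable_of_Iic fun c => ?_
  have : (fun a => sInf (φ '' A a)) ⁻¹' Set.Iic c = {a | (A a ∩ {x | φ x ≤ c}).Nonempty} := by
    ext a
    exact hA.sInf_le_iff hφ a c
  rw [this]
  exact hA.measurableSet _ (isClosed_le hφ continuous_const)

/-- The minimizers of a continuous function again form a measurable family. -/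
theorem argmin [T2Space X] (hA : MeasurableCompactValued A) {φ : X → ℝ} (hφ : Continuous φ) :
    MeasurableCompactValued fun a => A a ∩ {x | φ x = sInf (φ '' A a)} where
  isCompact a := (hA.isCompact a).inter_right (isClosed_eq hφ continuous_const)
  nonempty a := by
    obtain ⟨x, hx, hxe⟩ := ((hA.isCompact a).image hφ).sInf_mem ((hA.nonempty a).image φ)
    exact ⟨x, hx, hxe⟩
  measurableSet D hD := by
    -- A minimizer lies in `D` exactly when `A a ∩ D` is nonempty and contains, for every rational
    -- `q` above the minimum, a point with `φ ≤ q`: the minimum of `φ` on the compact set `A a ∩ D`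
    -- cannot then exceed that on `A a`.
    have : {a | ((A a ∩ {x | φ x = sInf (φ '' A a)}) ∩ D).Nonempty} =
        {a | (A a ∩ D).Nonempty} ∩ ⋂ q : ℚ, ({a | sInf (φ '' A a) < q}ᶜ ∪
          {a | (A a ∩ (D ∩ {x | φ x ≤ q})).Nonempty}) := by
      ext a
      constructor
      · rintro ⟨x, ⟨hx, hxe⟩, hxD⟩
        refine ⟨⟨x, hx, hxD⟩, Set.mem_iInter.2 fun q => ?_⟩
        by_cases hq : sInf (φ '' A a) < q
        · exact Or.inr ⟨x, hx, hxD, by rw [Set.mem_ofPred_eq, hxe]; exact hq.le⟩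
        · exact Or.inl hq
      · rintro ⟨hne, hq⟩
        obtain ⟨x, ⟨hx, hxD⟩, hmin⟩ :=
          ((hA.isCompact a).inter_right hD).exists_isMinOn hne hφ.continuousOn
        refine ⟨x, ⟨hx, le_antisymm ?_
          (csInf_le ((hA.isCompact a).image hφ).bddBelow ⟨x, hx, rfl⟩)⟩, hxD⟩
        by_contra! hlt
        obtain ⟨q, hq1, hq2⟩ := exists_rat_btwn hlt
        rcases Set.mem_iInter.1 hq q with h | ⟨y, hy, hyD, hyq⟩
        · exact h hq1
        · exact absurd (hmin ⟨hy, hyD⟩) (not_le.2 (lt_of_le_of_lt hyq hq2))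
    rw [this]
    refine (hA.measurableSet D hD).inter (MeasurableSet.iInter fun q => ?_)
    exact (measurableSet_lt (hA.measurable_sInf hφ) measurable_const).compl.union
      (hA.measurableSet _ (hD.inter (isClosed_le hφ continuous_const)))

/-- Lexicographic minimization: each step passes to the minimizers of the next function, on which
that function is constant with a measurable value. -/
theorem exists_common_minimizer [T2Space X] (hA : MeasurableCompactValued A) (φ : ℕ → X → ℝ)
    (hφ : ∀ n, Continuous (φ n)) (n : ℕ) :
    ∃ (A' : α → Set X) (m : ℕ → α → ℝ), MeasurableCompactValued A' ∧ (∀ i, Measurable (m i)) ∧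
      ∀ a, A' a ⊆ A a ∧ ∀ x ∈ A' a, ∀ i < n, φ i x = m i a := by
  induction n with
  | zero => exact ⟨A, fun _ _ => 0, hA, fun _ => measurable_const, fun a => ⟨subset_rfl, by simp⟩⟩
  | succ n ih =>
    obtain ⟨A', m, hA', hm, h⟩ := ih
    refine ⟨_, Function.update m n fun a => sInf (φ n '' A' a), hA'.argmin (hφ n), fun i => ?_,
      fun a => ⟨Set.inter_subset_left.trans (h a).1, fun x hx i hi => ?_⟩⟩
    · rcases eq_or_ne i n with rfl | hi
      · simpa using hA'.measurable_sInf (hφ i)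
      · simpa [hi] using hm i
    · rcases eq_or_ne i n with rfl | hne
      · simpa using hx.2
      · simpa [hne] using (h a).2 x hx.1 i (by omega)

/-- For the coordinate functions, lexicographic minimization leaves a single point, whose
coordinates are the measurable minimal values. -/
theorem exists_measurable_selection {d : ℕ} {A : α → Set (Vec d)}
    (hA : MeasurableCompactValued A) : ∃ s : α → Vec d, Measurable s ∧ ∀ a, s a ∈ A a := by
  obtain ⟨A', m, hA', hm, h⟩ := hA.exists_common_minimizer
    (fun i x => if hi : i < d then x ⟨i, hi⟩ else 0)
    (fun i => by
      by_cases hi : i < d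
      · simp only [hi, dite_true]; fun_prop
      · simp only [hi, dite_false]; fun_prop) d
  refine ⟨fun a => WithLp.toLp 2 fun i : Fin d => m i a, ?_, fun a => ?_⟩
  · exact (WithLp.measurable_toLp 2 _).comp (measurable_pi_lambda _ fun i => hm i)
  · obtain ⟨x, hx⟩ := hA'.nonempty a
    have : (WithLp.toLp 2 fun i : Fin d => m i a) = x := by
      ext i
      have := (h a).2 x hx i i.2
      simpa using this.symm
    simp only [this]
    exact (h a).1 hx

end MeasurableCompactValued

/-- A normal integrand has a measurable minimizer over a nonempty compact set. -/
theorem NormalIntegrand.exists_measurable_minimizer {U H : Type*} [TopologicalSpace U]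
    [TopologicalSpace.MetrizableSpace U] [SecondCountableTopology U] [MeasurableSpace U]
    [OpensMeasurableSpace U] [MeasurableSpace H] {d : ℕ} {f : U × Vec d → H → ℝ≥0∞}
    (hf : NormalIntegrand f) {K : Set (Vec d)} (hK : IsCompact K) (hne : K.Nonempty) :
    ∃ s : U × H → Vec d, Measurable s ∧
      ∀ p, s p ∈ K ∧ f (p.1, s p) p.2 = ⨅ x ∈ K, f (p.1, x) p.2 := by
  have key : MeasurableCompactValued fun p : U × H =>
      K ∩ {x | f (p.1, x) p.2 ≤ ⨅ x ∈ K, f (p.1, x) p.2} := by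
    have hcl : ∀ p : U × H, IsClosed {x | f (p.1, x) p.2 ≤ ⨅ x ∈ K, f (p.1, x) p.2} := fun p =>
      ((hf.lowerSemicontinuous p.2).comp (Continuous.prodMk_right p.1)).isClosed_preimage _
    have hne' : ∀ p : U × H,
        (K ∩ {x | f (p.1, x) p.2 ≤ ⨅ x ∈ K, f (p.1, x) p.2}).Nonempty := fun p => by
      obtain ⟨x, hx, hxe⟩ := hf.exists_eq_biInf hK hne p.1 p.2
      exact ⟨x, hx, hxe.le⟩
    refine ⟨fun p => hK.inter_right (hcl p), hne', fun D hD => ?_⟩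
    -- The case split is needed because an infimum over the empty set is `⊤`, not a minimum.
    rcases (K ∩ D).eq_empty_or_nonempty with hKD | hKD
    · convert MeasurableSet.empty
      ext p
      simp only [Set.mem_ofPred_eq, Set.mem_empty_iff_false, iff_false]
      rintro ⟨x, ⟨hx, -⟩, hxD⟩
      exact (hKD ▸ (⟨hx, hxD⟩ : x ∈ K ∩ D) : x ∈ (∅ : Set _))
    · have hKc := hK.inter_right hD
      -- Some minimizer lies in `D` exactly when the minimum over `K ∩ D` does not exceed that over
      -- `K`, and both minima are normal integrands.
      have : {p : U × H | (K ∩ {x | f (p.1, x) p.2 ≤ ⨅ x ∈ K, f (p.1, x) p.2} ∩ D).Nonempty} =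
          {p : U × H | ⨅ x ∈ K ∩ D, f (p.1, x) p.2 ≤ ⨅ x ∈ K, f (p.1, x) p.2} := by
        ext p
        constructor
        · rintro ⟨x, ⟨hx, hxe⟩, hxD⟩
          exact le_trans (iInf₂_le (f := fun x (_ : x ∈ K ∩ D) => f (p.1, x) p.2) x ⟨hx, hxD⟩) hxe
        · intro hp
          obtain ⟨x, hx, hxe⟩ := hf.exists_eq_biInf hKc hKD p.1 p.2
          exact ⟨x, ⟨hx.1, hxe.le.trans hp⟩, hx.2⟩
      rw [this]
      exact measurableSet_le (hf.biInf hKc hKD).measurable (hf.biInf hK hne).measurable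
  obtain ⟨s, hs, hsA⟩ := key.exists_measurable_selection
  exact ⟨s, hs, fun p => ⟨(hsA p).1, le_antisymm (hsA p).2 (iInf₂_le (s p) (hsA p).1)⟩⟩

/-! ### Histories, their laws and conditional laws -/

theorem measurable_snoc {m : ℕ → ℕ} (t : ℕ) :
    Measurable fun p : ExoHist m t × Vec (m (t + 1)) => (Fin.snoc p.1 p.2 : ExoHist m (t + 1)) := by
  refine measurable_pi_lambda _ fun i => ?_
  refine Fin.lastCases ?_ (fun j => ?_) i
  · simpa using measurable_snd
  · simp only [Fin.snoc_castSucc]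
    exact (measurable_pi_apply j).comp measurable_fst

theorem measurable_init {m : ℕ → ℕ} (t : ℕ) :
    Measurable fun h : ExoHist m (t + 1) => (Fin.init h : ExoHist m t) :=
  measurable_pi_lambda _ fun i => measurable_pi_apply i.castSucc

theorem coe_eq_ofReal_sub {c : ℝ} {b : ℝ≥0} (h : 0 ≤ c + b) :
    (c : EReal) = ((ENNReal.ofReal (c + b) : ℝ≥0∞) : EReal) - ((b : ℝ≥0∞) : EReal) := by
  rw [EReal.coe_ennreal_ofReal, max_eq_left h, EReal.coe_nnreal_eq_coe_real, ← EReal.coe_sub]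
  simp

namespace Model

variable {Ω₁ Ω₂ : Type*} [MeasurableSpace Ω₁] [MeasurableSpace Ω₂] (M : Model Ω₁ Ω₂)

instance : IsProbabilityMeasure M.P := by unfold P; infer_instance
-- Beyond the horizon the processes need not be measurable and a push-forward may be zero, so only
-- finiteness holds for every `t`.
instance (t : ℕ) : IsFiniteMeasure (M.lawExo t) := by unfold lawExo; infer_instance
instance (t : ℕ) : IsFiniteMeasure (M.lawZ t) := by unfold lawZ; infer_instance
instance (t : ℕ) : IsMarkovKernel (M.condLaw t) := by unfold condLaw; infer_instance

theorem measurable_exo {t : ℕ} (ht : t ≤ M.T) : Measurable (M.exo t) :=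
  measurable_pi_lambda _ fun i => M.measurable_ξ _ (by omega) (by omega)

theorem measurable_endo {t : ℕ} (ht : t ≤ M.T + 1) : Measurable (M.endo t) :=
  measurable_pi_lambda _ fun i => M.measurable_ζ _ (by omega)

theorem isProbabilityMeasure_lawExo {t : ℕ} (ht : t ≤ M.T) : IsProbabilityMeasure (M.lawExo t) :=
  Measure.isProbabilityMeasure_map (M.measurable_exo ht).aemeasurable

theorem isProbabilityMeasure_lawZ {t : ℕ} (ht : t ≤ M.T) : IsProbabilityMeasure (M.lawZ t) :=
  Measure.isProbabilityMeasure_map (M.measurable_ζ t ht).aemeasurable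

theorem exo_succ (t : ℕ) (ω : Ω₁) : M.exo (t + 1) ω = Fin.snoc (M.exo t ω) (M.ξ (t + 1) ω) := by
  funext i
  refine Fin.lastCases ?_ (fun j => ?_) i
  · simp [exo]
  · simp [exo]

theorem map_exo_ξ {t : ℕ} (ht : t + 1 ≤ M.T) :
    M.P₁.map (fun ω => (M.exo t ω, M.ξ (t + 1) ω)) = M.lawExo t ⊗ₘ M.condLaw t :=
  (compProd_map_condDistrib (M.measurable_ξ (t + 1) (by omega) ht).aemeasurable).symm

theorem map_snoc_lawExo {t : ℕ} (ht : t + 1 ≤ M.T) :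
    (M.lawExo t ⊗ₘ M.condLaw t).map
      (fun p : ExoHist M.dimXi t × Vec (M.dimXi (t + 1)) =>
        (Fin.snoc p.1 p.2 : ExoHist M.dimXi (t + 1))) = M.lawExo (t + 1) := by
  rw [← M.map_exo_ξ ht, Measure.map_map (measurable_snoc t)
    ((M.measurable_exo (by omega)).prodMk (M.measurable_ξ (t + 1) (by omega) ht))]
  unfold lawExo
  congr 1
  funext ω
  exact (M.exo_succ t ω).symm

/-- This carries almost sure facts about stage `t + 1` one step back in the induction. -/
theorem ae_ae_snoc {t : ℕ} (ht : t + 1 ≤ M.T) {p : ExoHist M.dimXi (t + 1) → Prop}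
    (h : ∀ᵐ h ∂M.lawExo (t + 1), p h) :
    ∀ᵐ h ∂M.lawExo t, ∀ᵐ y ∂M.condLaw t h, p (Fin.snoc h y) := by
  rw [← M.map_snoc_lawExo ht] at h
  exact Measure.ae_ae_of_ae_compProd (ae_of_ae_map (measurable_snoc t).aemeasurable h)

theorem lintegral_lawExo_succ {t : ℕ} (ht : t + 1 ≤ M.T) {f : ExoHist M.dimXi (t + 1) → ℝ≥0∞}
    (hf : Measurable f) :
    ∫⁻ h, f h ∂M.lawExo (t + 1) =
      ∫⁻ h, ∫⁻ y, f (Fin.snoc h y) ∂M.condLaw t h ∂M.lawExo t := by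
  rw [← M.map_snoc_lawExo ht, lintegral_map hf (measurable_snoc t)]
  exact Measure.lintegral_compProd (hf.comp (measurable_snoc t))

theorem continuous_step (hCont : M.ContinuousData) {t : ℕ} (ht : t < M.T) :
    Continuous fun p : Vec (M.dimS t) × Vec (M.dimX t) × ExoHist M.dimXi t × Vec (M.dimZ t) =>
      M.step t p.1 p.2.1 p.2.2.1 p.2.2.2 := by
  cases t with
  | zero =>
    exact hCont.trans₀.comp (f := fun p : Vec (M.dimS 0) × Vec (M.dimX 0) × ExoHist M.dimXi 0 ×
      Vec (M.dimZ 0) => (p.1, p.2.1, p.2.2.2)) (by fun_prop)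
  | succ t =>
    exact (hCont.trans t ht).comp (f := fun p : Vec (M.dimS (t + 1)) × Vec (M.dimX (t + 1)) ×
      ExoHist M.dimXi (t + 1) × Vec (M.dimZ (t + 1)) =>
        (p.1, p.2.1, p.2.2.1 (Fin.last t), p.2.2.2)) (by fun_prop)

/-! ### Bounds for the data -/

/-- Measurable integrable lower bounds for the costs, and radii of balls that contain the feasible
sets. -/
structure Envelope where
  /-- the cost of stage `t` is at least `-B t` -/
  B : (t : ℕ) → ExoHist M.dimXi t × Vec (M.dimZ t) → ℝ≥0
  /-- the feasible decisions of stage `t` have norm at most `R t` -/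
  R : ℕ → ℝ≥0
  measurable_B : ∀ t, Measurable (B t)
  lintegral_B_ne_top : ∀ t, t ≤ M.T → ∫⁻ p, B t p ∂(M.lawExo t).prod (M.lawZ t) ≠ ⊤
  lower : ∀ t, 1 ≤ t → t ≤ M.T → ∀ᵐ p ∂(M.lawExo t).prod (M.lawZ t), ∀ s x,
    0 ≤ M.C t s x p.1 p.2 + B t p
  lower_zero : ∀ᵐ z ∂M.lawZ 0, ∀ x ∈ M.X₀, 0 ≤ M.C 0 M.s₀ x M.hist₀ z + B 0 (M.hist₀, z)
  feas_subset : ∀ t, t < M.T → ∀ᵐ h ∂M.lawExo (t + 1), ∀ s x,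
    M.feas t s x h ⊆ Metric.closedBall 0 (R (t + 1))

theorem exists_measurable_bound {α : Type*} [MeasurableSpace α] {μ : Measure α} {b : α → ℝ}
    (hb : Integrable b μ) :
    ∃ B : α → ℝ≥0, Measurable B ∧ ∫⁻ a, B a ∂μ ≠ ⊤ ∧ ∀ᵐ a ∂μ, b a ≤ B a := by
  obtain ⟨f, hf, hbf⟩ := hb.aestronglyMeasurable.aemeasurable
  refine ⟨fun a => (f a).toNNReal, hf.real_toNNReal, ?_, ?_⟩
  · have : Integrable f μ := hb.congr hbf
    exact (lintegral_ofReal_le_lintegral_enorm f).trans_lt this.2 |>.ne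
  · filter_upwards [hbf] with a ha
    rw [ha]
    exact Real.le_coe_toNNReal _

theorem exists_envelope (hInt : M.IntegrableCosts) (hInit : M.InitialCost)
    (hBdd : M.BoundedFeasibleSets) : Nonempty M.Envelope := by
  have h1 : ∀ t, ∃ B : ExoHist M.dimXi (t + 1) × Vec (M.dimZ (t + 1)) → ℝ≥0, Measurable B ∧
      (t < M.T → ∫⁻ p, B p ∂(M.lawExo (t + 1)).prod (M.lawZ (t + 1)) ≠ ⊤ ∧
        ∀ᵐ p ∂(M.lawExo (t + 1)).prod (M.lawZ (t + 1)), ∀ s x,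
          0 ≤ M.C (t + 1) s x p.1 p.2 + B p) := by
    intro t
    by_cases ht : t < M.T
    · obtain ⟨b, -, hbi, hb⟩ := hInt.lower (t + 1) (by omega) ht
      obtain ⟨B, hB, hBi, hBb⟩ := exists_measurable_bound hbi
      refine ⟨B, hB, fun _ => ⟨hBi, ?_⟩⟩
      filter_upwards [hb, hBb] with p h1 h2 s x
      linarith [h1 s x]
    · exact ⟨0, measurable_const, fun h => absurd h ht⟩
  obtain ⟨b, -, hbi, hb⟩ := hInit.lower
  obtain ⟨B₀, hB₀, hB₀i, hB₀b⟩ := exists_measurable_bound hbi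
  choose B hB hB' using h1
  have h2 : ∀ t, ∃ r : ℝ≥0, t < M.T → ∀ᵐ h ∂M.lawExo (t + 1), ∀ s x,
      M.feas t s x h ⊆ Metric.closedBall 0 r := by
    intro t
    by_cases ht : t < M.T
    · obtain ⟨K, hK, hsub⟩ := hBdd t ht
      obtain ⟨r, hr⟩ := hK.subset_closedBall 0
      refine ⟨r.toNNReal, fun _ => ?_⟩
      filter_upwards [hsub] with h hh s x
      exact (hh s x).trans (hr.trans (Metric.closedBall_subset_closedBall (Real.le_coe_toNNReal r)))
    · exact ⟨0, fun h => absurd h ht⟩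
  choose R hR using h2
  -- The bound of stage `0` ignores the one-point history. Constraint data with index `t` belong to
  -- stage `t + 1`, which explains the shift in the radii.
  refine ⟨⟨fun t => match t with
    | 0 => fun p => B₀ p.2
    | t + 1 => B t, fun t => R (t - 1), fun t => ?_, fun t ht => ?_, fun t ht ht' => ?_, ?_,
    fun t ht => ?_⟩⟩
  · cases t with
    | zero => exact hB₀.comp measurable_snd
    | succ t => exact hB t
  · cases t with
    | zero =>
      have := M.isProbabilityMeasure_lawExo ht
      rw [lintegral_prod _ (by fun_prop)]
      simpa using hB₀i
    | succ t => exact (hB' t ht).1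
  · cases t with
    | zero => omega
    | succ t => exact (hB' t ht').2
  · filter_upwards [hb, hB₀b] with z h1 h2 x hx
    show 0 ≤ M.C 0 M.s₀ x M.hist₀ z + B₀ z
    linarith [h1 x hx]
  · exact hR t ht

/-- The infinite penalty for the violation of the constraints of stage `t + 1`. -/
noncomputable def penalty (t : ℕ)
    (u : (Vec (M.dimS (t + 1)) × Vec (M.dimX t)) × Vec (M.dimX (t + 1)))
    (h : ExoHist M.dimXi (t + 1)) : ℝ≥0∞ :=
  ⨆ n : ℕ, n * ∑ i, ENNReal.ofReal (M.g t i u.1.1 u.2 u.1.2 h)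

theorem penalty_of_mem_feas {t : ℕ} {s : Vec (M.dimS (t + 1))} {x : Vec (M.dimX t)}
    {x' : Vec (M.dimX (t + 1))} {h : ExoHist M.dimXi (t + 1)} (hx : x' ∈ M.feas t s x h) :
    M.penalty t ((s, x), x') h = 0 := by
  have : ∑ i, ENNReal.ofReal (M.g t i s x' x h) = 0 :=
    Finset.sum_eq_zero fun i _ => ENNReal.ofReal_of_nonpos (hx i)
  simp [penalty, this]

theorem penalty_of_notMem_feas {t : ℕ} {s : Vec (M.dimS (t + 1))} {x : Vec (M.dimX t)}
    {x' : Vec (M.dimX (t + 1))} {h : ExoHist M.dimXi (t + 1)} (hx : x' ∉ M.feas t s x h) :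
    M.penalty t ((s, x), x') h = ⊤ := by
  have hne : ∑ i, ENNReal.ofReal (M.g t i s x' x h) ≠ 0 := by
    intro h0
    refine hx fun i => ?_
    rw [Finset.sum_eq_zero_iff] at h0
    exact ENNReal.ofReal_eq_zero.1 (h0 i (Finset.mem_univ i))
  simp only [penalty]
  rw [← ENNReal.iSup_mul, ENNReal.iSup_natCast, ENNReal.top_mul hne]

/-- Each finite multiple of the total violation is continuous, and the multiples increase to the
penalty. -/
theorem normalIntegrand_penalty (hCont : M.ContinuousData) {t : ℕ} (ht : t < M.T) :
    NormalIntegrand (M.penalty t) := by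
  refine NormalIntegrand.iSup_of_monotone (fun n h => ?_) (fun n u => ?_) fun u h n m hnm => ?_
  · refine (ENNReal.continuous_const_mul (ENNReal.natCast_ne_top n)).comp ?_
    refine continuous_finsetSum _ fun i _ => ENNReal.continuous_ofReal.comp ?_
    exact (hCont.constraint t ht i).comp (f := fun u : (Vec (M.dimS (t + 1)) × Vec (M.dimX t)) ×
      Vec (M.dimX (t + 1)) => (u.1.1, u.2, u.1.2, h)) (by fun_prop)
  · refine Measurable.const_mul ?_ _
    refine Finset.measurable_sum _ fun i _ => ENNReal.measurable_ofReal.comp ?_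
    exact ((hCont.constraint t ht i).comp (f := fun h : ExoHist M.dimXi (t + 1) =>
      (u.1.1, u.2, u.1.2, h)) (by fun_prop)).measurable
  · exact mul_le_mul_left (by exact_mod_cast hnm) _

/-- The value of the stages `t + 1, …, T` as a function of `s_{t+1}`, `x_t` and `ξ_[t+1]`. -/
noncomputable def tail (t : ℕ) (s : Vec (M.dimS (t + 1))) (x : Vec (M.dimX t))
    (h : ExoHist M.dimXi (t + 1)) : EReal :=
  ⨅ x' ∈ M.feas t s x h, M.stageObj (t + 1) s x' h

theorem value_eq_tail {t : ℕ} (ht : t < M.T) (s : Vec (M.dimS t)) (x : Vec (M.dimX t))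
    (h : ExoHist M.dimXi (t + 1)) (z : Vec (M.dimZ t)) :
    M.value t s x h z = M.tail t (M.step t s x (Fin.init h) z) x h :=
  M.value_eq t ht s x h z

/-- The two recursions differ only in whether the transition is applied before or inside the value
function; the identity is formal and needs no assumption on the data. -/
theorem nestedTail_eq_tail (k t : ℕ) (ht : t + 1 + k = M.T) (s : Vec (M.dimS (t + 1)))
    (x : Vec (M.dimX t)) (h : ExoHist M.dimXi (t + 1)) :
    M.nestedTail k t s x h = M.tail t s x h := by
  induction k generalizing t with
  | zero =>
    have : ¬ t + 1 < M.T := by omega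
    simp only [nestedTail, tail, stageObj, this, if_false, lastObj]
  | succ k ih =>
    have : t + 1 < M.T := by omega
    simp only [nestedTail, tail, stageObj, this, if_true, bellmanObj]
    refine iInf_congr fun x' => iInf_congr fun _ => ?_
    congr 1
    funext p
    rw [ih (t + 1) (by omega), M.value_eq_tail this, Fin.init_snoc]

theorem nestedValue_eq_v₀ : M.nestedValue = M.v₀ := by
  have hT := M.one_le_T
  unfold nestedValue v₀ initObj
  refine iInf_congr fun x => iInf_congr fun _ => ?_
  congr 1
  funext z
  congr 2
  funext y
  rw [M.nestedTail_eq_tail (M.T - 1) 0 (by omega), M.value_eq_tail hT,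
    Subsingleton.elim (Fin.init y) M.hist₀]

/-! ### The shifted, penalized recursion -/

namespace Envelope

variable {M} (E : M.Envelope)

/-- The cost of stage `t`, shifted by its lower bound. -/
noncomputable def shiftedCost (t : ℕ) (u : Vec (M.dimS t) × Vec (M.dimX t))
    (p : ExoHist M.dimXi t × Vec (M.dimZ t)) : ℝ≥0∞ :=
  ENNReal.ofReal (M.C t u.1 u.2 p.1 p.2 + E.B t p)

/-- The conditional expectation of the sum of the lower bounds of the stages `t, …, t + k`. -/
noncomputable def slack : (k t : ℕ) → ExoHist M.dimXi t → ℝ≥0∞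
  | 0, t, h => ∫⁻ z, E.B t (h, z) ∂M.lawZ t
  | k + 1, t, h => ∫⁻ z, E.B t (h, z) ∂M.lawZ t +
      ∫⁻ y, slack k (t + 1) (Fin.snoc h y) ∂M.condLaw t h

/-- The shifted objective of stage `t`, with `k` further stages after it. -/
noncomputable def obj : (k t : ℕ) → Vec (M.dimS t) × Vec (M.dimX t) → ExoHist M.dimXi t → ℝ≥0∞
  | 0, t, u, h => ∫⁻ z, E.shiftedCost t u (h, z) ∂M.lawZ t
  | k + 1, t, u, h => ∫⁻ p, E.shiftedCost t u (h, p.2) +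
      (⨅ x' ∈ Metric.closedBall (0 : Vec (M.dimX (t + 1))) (E.R (t + 1)),
        (M.penalty t ((M.step t u.1 u.2 h p.2, u.2), x') (Fin.snoc h p.1) +
          obj k (t + 1) (M.step t u.1 u.2 h p.2, x') (Fin.snoc h p.1)))
      ∂(M.condLaw t h).prod (M.lawZ t)

/-- The shifted value of the stages from `t + 1` on, with `k` further stages after it. -/
noncomputable def val (k t : ℕ) (u : Vec (M.dimS (t + 1)) × Vec (M.dimX t))
    (h : ExoHist M.dimXi (t + 1)) : ℝ≥0∞ :=
  ⨅ x' ∈ Metric.closedBall (0 : Vec (M.dimX (t + 1))) (E.R (t + 1)),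
    (M.penalty t (u, x') h + E.obj k (t + 1) (u.1, x') h)

theorem isCompact_ball (t : ℕ) : IsCompact (Metric.closedBall (0 : Vec (M.dimX t)) (E.R t)) :=
  isCompact_closedBall _ _

theorem nonempty_ball (t : ℕ) : (Metric.closedBall (0 : Vec (M.dimX t)) (E.R t)).Nonempty :=
  ⟨0, Metric.mem_closedBall_self (E.R t).2⟩

theorem continuous_shiftedCost (hCont : M.ContinuousData) {t : ℕ} (h1 : 1 ≤ t) (ht : t ≤ M.T)
    (p : ExoHist M.dimXi t × Vec (M.dimZ t)) : Continuous fun u => E.shiftedCost t u p := by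
  refine ENNReal.continuous_ofReal.comp (Continuous.add ?_ continuous_const)
  exact (hCont.cost t h1 ht).comp (f := fun u : Vec (M.dimS t) × Vec (M.dimX t) =>
    (u.1, u.2, p.1, p.2)) (by fun_prop)

theorem measurable_shiftedCost (hCont : M.ContinuousData) {t : ℕ} (h1 : 1 ≤ t) (ht : t ≤ M.T) :
    Measurable fun q : (Vec (M.dimS t) × Vec (M.dimX t)) × (ExoHist M.dimXi t × Vec (M.dimZ t)) =>
      E.shiftedCost t q.1 q.2 := by
  refine ENNReal.measurable_ofReal.comp (Measurable.add ?_
    ((E.measurable_B t).coe_nnreal_real.comp measurable_snd))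
  exact ((hCont.cost t h1 ht).comp (f := fun q : (Vec (M.dimS t) × Vec (M.dimX t)) ×
    (ExoHist M.dimXi t × Vec (M.dimZ t)) => (q.1.1, q.1.2, q.2.1, q.2.2)) (by fun_prop)).measurable

theorem normalIntegrand_shiftedCost (hCont : M.ContinuousData) {t : ℕ} (h1 : 1 ≤ t)
    (ht : t ≤ M.T) : NormalIntegrand (E.shiftedCost t) :=
  .of_continuous_measurable (E.continuous_shiftedCost hCont h1 ht) fun _ =>
    (E.measurable_shiftedCost hCont h1 ht).comp measurable_prodMk_left

theorem normalIntegrand_penalty_add (hCont : M.ContinuousData) {k t : ℕ} (ht : t < M.T)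
    (h : NormalIntegrand (E.obj k (t + 1))) :
    NormalIntegrand fun (q : (Vec (M.dimS (t + 1)) × Vec (M.dimX t)) × Vec (M.dimX (t + 1)))
      (h : ExoHist M.dimXi (t + 1)) => M.penalty t q h + E.obj k (t + 1) (q.1.1, q.2) h :=
  (M.normalIntegrand_penalty hCont ht).add
    (h.comp (ψ := id) (φ := fun (q : (Vec (M.dimS (t + 1)) × Vec (M.dimX t)) ×
      Vec (M.dimX (t + 1))) _ => (q.1.1, q.2)) (fun _ => by fun_prop)
      (fun _ => measurable_const) measurable_id)

theorem normalIntegrand_val_of_obj (hCont : M.ContinuousData) {k t : ℕ} (ht : t < M.T)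
    (h : NormalIntegrand (E.obj k (t + 1))) : NormalIntegrand (E.val k t) :=
  (E.normalIntegrand_penalty_add hCont ht h).biInf (E.isCompact_ball (t + 1))
    (E.nonempty_ball (t + 1))

/-- Backward induction: sums, continuous transitions, minimization over balls and integration all
preserve normal integrands. -/
theorem normalIntegrand_obj (hCont : M.ContinuousData) (k t : ℕ) (h1 : 1 ≤ t)
    (ht : t + k = M.T) : NormalIntegrand (E.obj k t) := by
  induction k generalizing t with
  | zero =>
    exact (E.normalIntegrand_shiftedCost hCont h1 (by omega)).lintegral
      (Kernel.const _ (M.lawZ t))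
  | succ k ih =>
    have hlt : t < M.T := by omega
    have hv := E.normalIntegrand_val_of_obj hCont hlt (ih (t + 1) (by omega) (by omega))
    have hs : NormalIntegrand fun (u : Vec (M.dimS t) × Vec (M.dimX t))
        (q : ExoHist M.dimXi t × (Vec (M.dimXi (t + 1)) × Vec (M.dimZ t))) =>
          E.shiftedCost t u (q.1, q.2.2) +
            E.val k t (M.step t u.1 u.2 q.1 q.2.2, u.2) (Fin.snoc q.1 q.2.1) := by
      refine ((E.normalIntegrand_shiftedCost hCont h1 hlt.le).comp (φ := fun u _ => u)
        (ψ := fun q : ExoHist M.dimXi t × (Vec (M.dimXi (t + 1)) × Vec (M.dimZ t)) =>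
          (q.1, q.2.2)) (fun _ => continuous_id) (fun _ => measurable_const) (by fun_prop)).add ?_
      refine hv.comp (φ := fun (u : Vec (M.dimS t) × Vec (M.dimX t))
        (q : ExoHist M.dimXi t × (Vec (M.dimXi (t + 1)) × Vec (M.dimZ t))) =>
          (M.step t u.1 u.2 q.1 q.2.2, u.2))
        (ψ := fun q => Fin.snoc q.1 q.2.1) (fun q => ?_) (fun u => ?_) ?_
      · refine Continuous.prodMk ?_ continuous_snd
        exact (M.continuous_step hCont hlt).comp (f := fun u : Vec (M.dimS t) × Vec (M.dimX t) =>
          (u.1, u.2, q.1, q.2.2)) (by fun_prop)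
      · refine Measurable.prodMk ?_ measurable_const
        exact ((M.continuous_step hCont hlt).comp (f := fun q : ExoHist M.dimXi t ×
          (Vec (M.dimXi (t + 1)) × Vec (M.dimZ t)) => (u.1, u.2, q.1, q.2.2))
          (by fun_prop)).measurable
      · exact (measurable_snoc t).comp (f := fun q : ExoHist M.dimXi t ×
          (Vec (M.dimXi (t + 1)) × Vec (M.dimZ t)) => (q.1, q.2.1)) (by fun_prop)
    -- The product kernel integrates over the pair `(ξ_{t+1}, ζ_t)` given the history.
    have := hs.lintegral (M.condLaw t ×ₖ Kernel.const _ (M.lawZ t))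
    simp only [Kernel.prod_apply, Kernel.const_apply] at this
    exact this

theorem normalIntegrand_val (hCont : M.ContinuousData) (k t : ℕ) (ht : t + 1 + k = M.T) :
    NormalIntegrand (E.val k t) :=
  E.normalIntegrand_val_of_obj hCont (by omega)
    (E.normalIntegrand_obj hCont k (t + 1) (by omega) ht)

/-! ### Integrability of the accumulated lower bounds -/

theorem measurable_slack (k t : ℕ) : Measurable (E.slack k t) := by
  induction k generalizing t with
  | zero => exact (E.measurable_B t).coe_nnreal_ennreal.lintegral_prod_right'
  | succ k ih =>
    refine Measurable.add (E.measurable_B t).coe_nnreal_ennreal.lintegral_prod_right' ?_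
    exact ((ih (t + 1)).comp (measurable_snoc t)).lintegral_kernel_prod_right'

theorem lintegral_lintegral_B (t : ℕ) :
    ∫⁻ h, ∫⁻ z, E.B t (h, z) ∂M.lawZ t ∂M.lawExo t =
      ∫⁻ p, E.B t p ∂(M.lawExo t).prod (M.lawZ t) :=
  (lintegral_prod _ (E.measurable_B t).coe_nnreal_ennreal.aemeasurable).symm

/-- Tower property: averaging the conditional expectation of the later slack over `ξ_[t]` is
averaging that slack over `ξ_[t+1]`. -/
theorem lintegral_slack (k t : ℕ) (ht : t + k ≤ M.T) :
    ∫⁻ h, E.slack k t h ∂M.lawExo t =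
      ∑ i ∈ Finset.range (k + 1),
        ∫⁻ p, E.B (t + i) p ∂(M.lawExo (t + i)).prod (M.lawZ (t + i)) := by
  induction k generalizing t with
  | zero =>
    simp only [zero_add, Finset.sum_range_one]
    exact E.lintegral_lintegral_B t
  | succ k ih =>
    rw [Finset.sum_range_succ']
    simp only [slack]
    rw [lintegral_add_left (E.measurable_B t).coe_nnreal_ennreal.lintegral_prod_right',
      ← M.lintegral_lawExo_succ (by omega) (E.measurable_slack k (t + 1)), ih (t + 1) (by omega),
      lintegral_lintegral_B, add_comm]
    congr 1
    refine Finset.sum_congr rfl fun i _ => ?_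
    rw [show t + 1 + i = t + (i + 1) by ring]

theorem lintegral_slack_ne_top (k t : ℕ) (ht : t + k ≤ M.T) :
    ∫⁻ h, E.slack k t h ∂M.lawExo t ≠ ⊤ := by
  rw [E.lintegral_slack k t ht]
  refine ENNReal.sum_ne_top.2 fun i hi => E.lintegral_B_ne_top _ ?_
  rw [Finset.mem_range] at hi
  omega

theorem ae_slack_ne_top (k t : ℕ) (ht : t + k ≤ M.T) :
    ∀ᵐ h ∂M.lawExo t, E.slack k t h ≠ ⊤ := by
  filter_upwards [ae_lt_top (E.measurable_slack k t) (E.lintegral_slack_ne_top k t ht)] with h hh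
  exact hh.ne

/-! ### The recursion as shifted recursion minus slack -/

theorem coe_cost_eq {t : ℕ} {s : Vec (M.dimS t)} {x : Vec (M.dimX t)}
    {p : ExoHist M.dimXi t × Vec (M.dimZ t)} (h : 0 ≤ M.C t s x p.1 p.2 + E.B t p) :
    ((M.C t s x p.1 p.2 : ℝ) : EReal) =
      (E.shiftedCost t (s, x) p : EReal) - (((E.B t p : ℝ≥0) : ℝ≥0∞) : EReal) :=
  coe_eq_ofReal_sub h

/-- The last stage. -/
theorem ae_lastObj_eq (hCont : M.ContinuousData) {t : ℕ} (h1 : 1 ≤ t) (ht : t = M.T) :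
    ∀ᵐ h ∂M.lawExo t, ∀ s x,
      QuasiIntegrable (M.lawZ t) (fun z => ((M.C t s x h z : ℝ) : EReal)) ∧
      M.lastObj t s x h = (E.obj 0 t (s, x) h : EReal) - (E.slack 0 t h : EReal) := by
  filter_upwards [Measure.ae_ae_of_ae_prod (E.lower t h1 ht.le),
    E.ae_slack_ne_top 0 t ht.le] with h hlow h2 s x
  refine expect_of_ae_eq_sub ?_ ?_ h2 ?_
  · exact ((E.measurable_shiftedCost hCont h1 ht.le).comp
      (measurable_const.prodMk measurable_prodMk_left)).aemeasurable
  · exact ((E.measurable_B t).coe_nnreal_ennreal.comp measurable_prodMk_left).aemeasurable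
  · filter_upwards [hlow] with z hz
    exact E.coe_cost_eq (p := (h, z)) (hz s x)

theorem measurable_val_step (hCont : M.ContinuousData) {k t : ℕ} (ht : t + 1 + k = M.T) :
    Measurable fun q : (Vec (M.dimS t) × Vec (M.dimX t)) × ExoHist M.dimXi t ×
        (Vec (M.dimXi (t + 1)) × Vec (M.dimZ t)) =>
      E.val k t (M.step t q.1.1 q.1.2 q.2.1 q.2.2.2, q.1.2) (Fin.snoc q.2.1 q.2.2.1) := by
  have h1 : Measurable fun q : (Vec (M.dimS t) × Vec (M.dimX t)) × ExoHist M.dimXi t ×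
        (Vec (M.dimXi (t + 1)) × Vec (M.dimZ t)) =>
      (M.step t q.1.1 q.1.2 q.2.1 q.2.2.2, q.1.2) :=
    (((M.continuous_step hCont (by omega)).comp (f := fun q : (Vec (M.dimS t) × Vec (M.dimX t)) ×
      ExoHist M.dimXi t × (Vec (M.dimXi (t + 1)) × Vec (M.dimZ t)) =>
        (q.1.1, q.1.2, q.2.1, q.2.2.2)) (by fun_prop)).measurable).prodMk (by fun_prop)
  have h2 : Measurable fun q : (Vec (M.dimS t) × Vec (M.dimX t)) × ExoHist M.dimXi t ×
        (Vec (M.dimXi (t + 1)) × Vec (M.dimZ t)) =>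
      (Fin.snoc q.2.1 q.2.2.1 : ExoHist M.dimXi (t + 1)) :=
    (measurable_snoc t).comp (f := fun q : (Vec (M.dimS t) × Vec (M.dimX t)) ×
      ExoHist M.dimXi t × (Vec (M.dimXi (t + 1)) × Vec (M.dimZ t)) => (q.2.1, q.2.2.1))
      (by fun_prop)
  have h3 := (E.normalIntegrand_val hCont k t ht).measurable
  have h4 := h3.comp (h1.prodMk h2)
  exact h4

/-- An intermediate stage. -/
theorem ae_bellmanObj_eq (hCont : M.ContinuousData) {k t : ℕ} (h1 : 1 ≤ t)
    (ht : t + 1 + k = M.T)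
    (hnext : ∀ᵐ h ∂M.lawExo (t + 1), ∀ s x,
      M.tail t s x h = (E.val k t (s, x) h : EReal) - (E.slack k (t + 1) h : EReal)) :
    ∀ᵐ h ∂M.lawExo t, ∀ s x,
      QuasiIntegrable ((M.condLaw t h).prod (M.lawZ t)) (fun p =>
        ((M.C t s x h p.2 : ℝ) : EReal) + M.value t s x (Fin.snoc h p.1) p.2) ∧
      M.bellmanObj t (M.value t) s x h =
        (E.obj (k + 1) t (s, x) h : EReal) - (E.slack (k + 1) t h : EReal) := by
  have hlt : t < M.T := by omega
  have := M.isProbabilityMeasure_lawZ hlt.le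
  -- The null set is discarded before `s` and `x` are introduced, and `hnext` holds for all states
  -- at once; this is essential, since the next state varies with `ζ_t`.
  filter_upwards [Measure.ae_ae_of_ae_prod (E.lower t h1 hlt.le),
    E.ae_slack_ne_top (k + 1) t (by omega), M.ae_ae_snoc hlt hnext] with h hlow hfin hn s x
  have hB : Measurable fun z => (E.B t (h, z) : ℝ≥0∞) :=
    (E.measurable_B t).coe_nnreal_ennreal.comp measurable_prodMk_left
  have hS : Measurable fun y => E.slack k (t + 1) (Fin.snoc h y) :=
    (E.measurable_slack k (t + 1)).comp ((measurable_snoc t).comp measurable_prodMk_left)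
  have hsl : ∫⁻ p, (E.B t (h, p.2) : ℝ≥0∞) + E.slack k (t + 1) (Fin.snoc h p.1)
      ∂(M.condLaw t h).prod (M.lawZ t) = E.slack (k + 1) t h := by
    refine (lintegral_add_left (hB.comp measurable_snd) _).trans ?_
    simp only [slack]
    congr 1
    · exact (lintegral_prod _ (hB.comp measurable_snd).aemeasurable).trans (by simp)
    · exact (lintegral_prod _ (hS.comp measurable_fst).aemeasurable).trans (by simp)
  have := expect_of_ae_eq_sub (μ := (M.condLaw t h).prod (M.lawZ t))
    (f := fun p => ((M.C t s x h p.2 : ℝ) : EReal) + M.value t s x (Fin.snoc h p.1) p.2)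
    (F := fun p => E.shiftedCost t (s, x) (h, p.2) +
      E.val k t (M.step t s x h p.2, x) (Fin.snoc h p.1))
    (H := fun p => (E.B t (h, p.2) : ℝ≥0∞) + E.slack k (t + 1) (Fin.snoc h p.1))
    ?_ ((hB.comp measurable_snd).add (hS.comp measurable_fst)).aemeasurable
    (by rw [hsl]; exact hfin) ?_
  · rw [hsl] at this
    exact this
  · refine AEMeasurable.fun_add (Measurable.aemeasurable ?_) (Measurable.aemeasurable ?_)
    · exact (E.measurable_shiftedCost hCont h1 hlt.le).comp
        (f := fun p : Vec (M.dimXi (t + 1)) × Vec (M.dimZ t) => ((s, x), (h, p.2))) (by fun_prop)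
    · have h5 := (E.measurable_val_step hCont ht).comp (f := fun p : Vec (M.dimXi (t + 1)) ×
        Vec (M.dimZ t) => ((s, x), h, p)) (by fun_prop)
      exact h5
  · have e1 : ∀ᵐ p ∂(M.condLaw t h).prod (M.lawZ t), ∀ s x,
        0 ≤ M.C t s x h p.2 + E.B t (h, p.2) :=
      Measure.quasiMeasurePreserving_snd.ae hlow
    have e2 : ∀ᵐ p ∂(M.condLaw t h).prod (M.lawZ t), ∀ s x, M.tail t s x (Fin.snoc h p.1) =
        (E.val k t (s, x) (Fin.snoc h p.1) : EReal) -
          (E.slack k (t + 1) (Fin.snoc h p.1) : EReal) :=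
      Measure.quasiMeasurePreserving_fst.ae hn
    filter_upwards [e1, e2] with p hp1 hp2
    rw [M.value_eq_tail hlt, Fin.init_snoc, hp2, E.coe_cost_eq (p := (h, p.2)) (hp1 s x),
      EReal_sub_add_sub]

/-- Feasibility is assumed outside a null set that depends on `(s, x)`; countably many pairs share
one null set. The least penalty over the ball is lower semicontinuous in `(s, x)` and vanishes on a
dense set, hence everywhere. Its minimizer is then feasible, since infeasible points have penalty
`⊤`. -/
theorem ae_feas_nonempty (E : M.Envelope) (hInt : M.IntegrableCosts)
    (hCont : M.ContinuousData) {t : ℕ} (ht : t < M.T) :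
    ∀ᵐ h ∂M.lawExo (t + 1), ∀ s x, (M.feas t s x h).Nonempty := by
  obtain ⟨D, hDc, hD⟩ := TopologicalSpace.exists_countable_dense
    (Vec (M.dimS (t + 1)) × Vec (M.dimX t))
  have h1 : ∀ᵐ h ∂M.lawExo (t + 1), ∀ u ∈ D, (M.feas t u.1 u.2 h).Nonempty := by
    refine (ae_ball_iff hDc).2 fun u _ => ?_
    obtain ⟨x', -, hx', -⟩ := hInt.finite t ht u.1 u.2
    filter_upwards [hx'] with h hh
    exact ⟨_, hh⟩
  have hN := M.normalIntegrand_penalty hCont ht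
  filter_upwards [h1, E.feas_subset t ht] with h hh hsub s x
  have hcl : IsClosed {u | ⨅ x' ∈ Metric.closedBall (0 : Vec (M.dimX (t + 1))) (E.R (t + 1)),
      M.penalty t (u, x') h ≤ 0} :=
    ((hN.biInf (E.isCompact_ball (t + 1)) (E.nonempty_ball (t + 1))).lowerSemicontinuous
      h).isClosed_preimage 0
  have hall := closure_minimal (fun u hu => by
    obtain ⟨x', hx'⟩ := hh u hu
    exact (iInf₂_le (f := fun x' (_ : x' ∈ Metric.closedBall (0 : Vec (M.dimX (t + 1)))
      (E.R (t + 1))) => M.penalty t (u, x') h) x' (hsub _ _ hx')).trans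
      (M.penalty_of_mem_feas hx').le : D ⊆ _) hcl (hD (s, x))
  obtain ⟨x', -, hx'⟩ := hN.exists_eq_biInf (E.isCompact_ball (t + 1)) (E.nonempty_ball (t + 1))
    (s, x) h
  refine ⟨x', by_contra fun hne => ?_⟩
  rw [M.penalty_of_notMem_feas hne] at hx'
  have := hx'.le.trans hall
  simp at this

/-- Facts about the decisions of stage `t + 1`, with `k` stages after it, for a given history. -/
structure Regular (k t : ℕ) (h : ExoHist M.dimXi (t + 1)) : Prop where
  slack_ne_top : E.slack k (t + 1) h ≠ ⊤
  stageObj_eq : ∀ s x, M.stageObj (t + 1) s x h =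
    (E.obj k (t + 1) (s, x) h : EReal) - (E.slack k (t + 1) h : EReal)
  tail_eq : ∀ s x, M.tail t s x h =
    (E.val k t (s, x) h : EReal) - (E.slack k (t + 1) h : EReal)
  val_le : ∀ s x, ∀ x' ∈ M.feas t s x h, E.val k t (s, x) h ≤ E.obj k (t + 1) (s, x') h
  exists_minimizer : ∀ s x, ∃ x' ∈ M.feas t s x h,
    E.obj k (t + 1) (s, x') h = E.val k t (s, x) h

theorem regular_of_stageObj_eq {k t : ℕ} {h : ExoHist M.dimXi (t + 1)}
    (hCont : M.ContinuousData) (ht : t + 1 + k = M.T) (hs : E.slack k (t + 1) h ≠ ⊤)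
    (hobj : ∀ s x, M.stageObj (t + 1) s x h =
      (E.obj k (t + 1) (s, x) h : EReal) - (E.slack k (t + 1) h : EReal))
    (hsub : ∀ s x, M.feas t s x h ⊆ Metric.closedBall 0 (E.R (t + 1)))
    (hne : ∀ s x, (M.feas t s x h).Nonempty) : E.Regular k t h := by
  have hle : ∀ s x, ∀ x' ∈ M.feas t s x h, E.val k t (s, x) h ≤ E.obj k (t + 1) (s, x') h := by
    intro s x x' hx'
    refine (iInf₂_le x' (hsub s x hx')).trans ?_
    rw [M.penalty_of_mem_feas hx', zero_add]
  have hex : ∀ s x, ∃ x' ∈ M.feas t s x h, E.obj k (t + 1) (s, x') h = E.val k t (s, x) h := by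
    intro s x
    -- If the value is `⊤`, every feasible decision attains it. Otherwise a minimizer of the
    -- penalized objective has finite penalty and is feasible.
    by_cases hv : E.val k t (s, x) h = ⊤
    · obtain ⟨x', hx'⟩ := hne s x
      exact ⟨x', hx', le_antisymm (by rw [hv]; exact le_top) (hle s x x' hx')⟩
    · obtain ⟨x', -, hx'⟩ := (E.normalIntegrand_penalty_add hCont (by omega)
        (E.normalIntegrand_obj hCont k (t + 1) (by omega) ht)).exists_eq_biInf
          (E.isCompact_ball (t + 1)) (E.nonempty_ball (t + 1)) (s, x) h
      by_cases hf : x' ∈ M.feas t s x h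
      · rw [M.penalty_of_mem_feas hf, zero_add] at hx'
        exact ⟨x', hf, hx'⟩
      · rw [M.penalty_of_notMem_feas hf, top_add] at hx'
        exact absurd hx'.symm hv
  refine ⟨hs, hobj, fun s x => ?_, hle, hex⟩
  unfold tail
  simp only [hobj]
  refine le_antisymm ?_ (le_iInf₂ fun x' hx' =>
    (EReal_sub_le_sub_right_iff hs).2 (hle s x x' hx'))
  obtain ⟨x', hx', he⟩ := hex s x
  rw [← he]
  exact iInf₂_le (f := fun x' (_ : x' ∈ M.feas t s x h) =>
    (E.obj k (t + 1) (s, x') h : EReal) - (E.slack k (t + 1) h : EReal)) x' hx'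

/-- Backward induction: `tail_eq` for the next stage identifies the integrand of the Bellman
objective, which gives `stageObj_eq` and with it all the other facts. -/
theorem ae_regular (hInt : M.IntegrableCosts) (hCont : M.ContinuousData) (k t : ℕ)
    (ht : t + 1 + k = M.T) : ∀ᵐ h ∂M.lawExo (t + 1), E.Regular k t h := by
  induction k generalizing t with
  | zero =>
    filter_upwards [E.ae_slack_ne_top 0 (t + 1) (by omega), E.feas_subset t (by omega),
      E.ae_feas_nonempty hInt hCont (by omega : t < M.T),
      E.ae_lastObj_eq hCont (by omega : 1 ≤ t + 1) (by omega)] with h h1 h2 h3 h4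
    have hlt : ¬ t + 1 < M.T := by omega
    refine E.regular_of_stageObj_eq hCont ht h1 (fun s x => ?_) h2 h3
    simp only [stageObj, hlt, if_false]
    exact (h4 s x).2
  | succ k ih =>
    have hlt : t + 1 < M.T := by omega
    filter_upwards [E.ae_slack_ne_top (k + 1) (t + 1) (by omega), E.feas_subset t (by omega),
      E.ae_feas_nonempty hInt hCont (by omega : t < M.T),
      E.ae_bellmanObj_eq hCont (by omega : 1 ≤ t + 1) (by omega : t + 1 + 1 + k = M.T)
        ((ih (t + 1) (by omega)).mono fun h hh => hh.tail_eq)] with h h1 h2 h3 h4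
    refine E.regular_of_stageObj_eq hCont ht h1 (fun s x => ?_) h2 h3
    simp only [stageObj, hlt, if_true]
    exact (h4 s x).2

/-- Measurable optimal decisions of stage `t + 1`. -/
theorem exists_measurable_decision (hInt : M.IntegrableCosts) (hCont : M.ContinuousData)
    (k t : ℕ) (ht : t + 1 + k = M.T) :
    ∃ π : Vec (M.dimS (t + 1)) × Vec (M.dimX t) × ExoHist M.dimXi (t + 1) → Vec (M.dimX (t + 1)),
      Measurable π ∧ ∀ᵐ h ∂M.lawExo (t + 1), ∀ s x, π (s, x, h) ∈ M.feas t s x h ∧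
        E.obj k (t + 1) (s, π (s, x, h)) h = E.val k t (s, x) h := by
  have hlt : t < M.T := by omega
  obtain ⟨f, hf, hf'⟩ := (E.normalIntegrand_penalty_add hCont hlt
    (E.normalIntegrand_obj hCont k (t + 1) (by omega) ht)).exists_measurable_minimizer
      (E.isCompact_ball (t + 1)) (E.nonempty_ball (t + 1))
  obtain ⟨g, hg, hg'⟩ := (M.normalIntegrand_penalty hCont hlt).exists_measurable_minimizer
    (E.isCompact_ball (t + 1)) (E.nonempty_ball (t + 1))
  classical
  -- Where the value is `⊤`, the penalized minimizer `f` may be infeasible, so the minimizer `g` of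
  -- the penalty alone is used there; it is feasible whenever a feasible decision exists in the
  -- ball.
  refine ⟨fun q => if E.val k t (q.1, q.2.1) q.2.2 = ⊤ then g ((q.1, q.2.1), q.2.2) else
    f ((q.1, q.2.1), q.2.2), ?_, ?_⟩
  · refine Measurable.ite ?_ (hg.comp (by fun_prop)) (hf.comp (by fun_prop))
    exact ((E.normalIntegrand_val hCont k t ht).measurable.comp
      (f := fun q : Vec (M.dimS (t + 1)) × Vec (M.dimX t) × ExoHist M.dimXi (t + 1) =>
        ((q.1, q.2.1), q.2.2)) (by fun_prop)) (measurableSet_singleton ⊤)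
  · filter_upwards [E.ae_regular hInt hCont k t ht, E.feas_subset t hlt,
      E.ae_feas_nonempty hInt hCont hlt] with h hreg hsub hne s x
    by_cases hv : E.val k t (s, x) h = ⊤
    · simp only [hv, if_true]
      have hmem : g ((s, x), h) ∈ M.feas t s x h := by
        by_contra hn
        obtain ⟨x', hx'⟩ := hne s x
        have h1 := (hg' ((s, x), h)).2
        rw [M.penalty_of_notMem_feas hn] at h1
        have h2 := iInf₂_le (f := fun x' (_ : x' ∈ Metric.closedBall (0 : Vec (M.dimX (t + 1)))
          (E.R (t + 1))) => M.penalty t ((s, x), x') h) x' (hsub s x hx')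
        rw [M.penalty_of_mem_feas hx'] at h2
        have h3 := h1.le.trans h2
        simp at h3
      refine ⟨hmem, top_le_iff.1 ?_⟩
      rw [← hv]
      exact hreg.val_le s x _ hmem
    · simp only [hv, if_false]
      have h1 : M.penalty t ((s, x), f ((s, x), h)) h + E.obj k (t + 1) (s, f ((s, x), h)) h =
        E.val k t (s, x) h := (hf' ((s, x), h)).2
      by_cases hmem : f ((s, x), h) ∈ M.feas t s x h
      · rw [M.penalty_of_mem_feas hmem, zero_add] at h1
        exact ⟨hmem, h1⟩
      · rw [M.penalty_of_notMem_feas hmem, top_add] at h1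
        exact absurd h1.symm hv

end Envelope
end Model
end MSPMDP

namespace MSPMDP
namespace Model

variable {Ω₁ Ω₂ : Type*} [MeasurableSpace Ω₁] [MeasurableSpace Ω₂] (M : Model Ω₁ Ω₂)

/-! ### Disintegration along the stages -/

theorem map_exo_ζ {t : ℕ} (ht : t ≤ M.T) :
    M.P.map (fun ω => (M.exo t ω.1, M.ζ t ω.2)) = (M.lawExo t).prod (M.lawZ t) :=
  (Measure.map_prod_map M.P₁ M.P₂ (M.measurable_exo ht) (M.measurable_ζ t ht)).symm

theorem measurable_exo_ζ {t : ℕ} (ht : t ≤ M.T) :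
    Measurable fun ω : Ω₁ × Ω₂ => (M.exo t ω.1, M.ζ t ω.2) :=
  ((M.measurable_exo ht).comp measurable_fst).prodMk ((M.measurable_ζ t ht).comp measurable_snd)

theorem ae_exo {t : ℕ} (ht : t ≤ M.T) {p : ExoHist M.dimXi t → Prop}
    (h : ∀ᵐ h ∂M.lawExo t, p h) : ∀ᵐ ω ∂M.P, p (M.exo t ω.1) :=
  Measure.quasiMeasurePreserving_fst.ae (ae_of_ae_map (M.measurable_exo ht).aemeasurable h)

/-- Mutual independence is applied to the disjoint index sets `{i | i < t}` and `{t}`. -/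
theorem map_endo_ζ {t : ℕ} (ht : t ≤ M.T) :
    M.P₂.map (fun ω => (M.endo t ω, M.ζ t ω)) = (M.P₂.map (M.endo t)).prod (M.lawZ t) := by
  have h := M.indep_ζ.indepFun_finset (Finset.univ.filter fun i : Fin (M.T + 1) => (i : ℕ) < t)
    {⟨t, Nat.lt_succ_of_le ht⟩} (by
      rw [Finset.disjoint_singleton_right]
      simp) (fun i => M.measurable_ζ i (by omega))
  have h' := h.comp
    (φ := fun a (i : Fin t) => a ⟨⟨i, by omega⟩, by simp⟩)
    (ψ := fun a => a ⟨⟨t, Nat.lt_succ_of_le ht⟩, by simp⟩)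
    (measurable_pi_lambda _ fun i => measurable_pi_apply _)
    (measurable_pi_apply (X := fun i : ({⟨t, Nat.lt_succ_of_le ht⟩} : Finset (Fin (M.T + 1))) =>
      Vec (M.dimZ i)) _)
  exact h'.map_prod_eq_prod_map_map (M.measurable_endo (by omega)).aemeasurable
    (M.measurable_ζ t ht).aemeasurable

/-- With `ω₁` frozen by Tonelli, only the independence of `ζ_t` from its past matters. -/
theorem lintegral_ζ {α : Type*} [MeasurableSpace α] {t : ℕ} (ht : t ≤ M.T) {a : Ω₁ → α}
    (ha : Measurable a) {Φ : α × EndoHist M.dimZ t × Vec (M.dimZ t) → ℝ≥0∞} (hΦ : Measurable Φ) :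
    ∫⁻ ω, Φ (a ω.1, M.endo t ω.2, M.ζ t ω.2) ∂M.P =
      ∫⁻ ω, ∫⁻ z, Φ (a ω.1, M.endo t ω.2, z) ∂M.lawZ t ∂M.P := by
  have he := M.measurable_endo (t := t) (by omega)
  have hz := M.measurable_ζ t ht
  have hm : Measurable fun q : α × EndoHist M.dimZ t => ∫⁻ z, Φ (q.1, q.2, z) ∂M.lawZ t :=
    Measurable.lintegral_prod_right' (f := fun q : (α × EndoHist M.dimZ t) × Vec (M.dimZ t) =>
      Φ (q.1.1, q.1.2, q.2)) (hΦ.comp (by fun_prop))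
  unfold P
  rw [lintegral_prod _ (by fun_prop), lintegral_prod _ (by
    exact (hm.comp (f := fun ω : Ω₁ × Ω₂ => (a ω.1, M.endo t ω.2)) (by fun_prop)).aemeasurable)]
  refine lintegral_congr fun ω₁ => ?_
  have hΦ' : Measurable fun q : EndoHist M.dimZ t × Vec (M.dimZ t) => Φ (a ω₁, q.1, q.2) :=
    hΦ.comp (by fun_prop)
  calc ∫⁻ ω₂, Φ (a ω₁, M.endo t ω₂, M.ζ t ω₂) ∂M.P₂
      = ∫⁻ q, Φ (a ω₁, q.1, q.2) ∂M.P₂.map (fun ω => (M.endo t ω, M.ζ t ω)) :=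
        (lintegral_map hΦ' (he.prodMk hz)).symm
    _ = ∫⁻ e, ∫⁻ z, Φ (a ω₁, e, z) ∂M.lawZ t ∂M.P₂.map (M.endo t) := by
        rw [M.map_endo_ζ ht, lintegral_prod _ hΦ'.aemeasurable]
    _ = _ := lintegral_map hΦ'.lintegral_prod_right' he

/-- Here `ω₂` is frozen instead: the product structure makes the conditional law of `ξ_{t+1}`
insensitive to the endogenous history. -/
theorem lintegral_ξ {t : ℕ} (ht : t + 1 ≤ M.T)
    {G : ExoHist M.dimXi t × Vec (M.dimXi (t + 1)) × EndoHist M.dimZ t → ℝ≥0∞}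
    (hG : Measurable G) :
    ∫⁻ ω, G (M.exo t ω.1, M.ξ (t + 1) ω.1, M.endo t ω.2) ∂M.P =
      ∫⁻ ω, ∫⁻ y, G (M.exo t ω.1, y, M.endo t ω.2) ∂M.condLaw t (M.exo t ω.1) ∂M.P := by
  have he := M.measurable_endo (t := t) (by omega)
  have hx := M.measurable_exo (t := t) (by omega)
  have hξ := M.measurable_ξ (t + 1) (by omega) ht
  have hm : Measurable fun q : ExoHist M.dimXi t × EndoHist M.dimZ t =>
      ∫⁻ y, G (q.1, y, q.2) ∂M.condLaw t q.1 :=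
    Measurable.lintegral_kernel_prod_right' (κ := (M.condLaw t).comap Prod.fst measurable_fst)
      (f := fun q : (ExoHist M.dimXi t × EndoHist M.dimZ t) × Vec (M.dimXi (t + 1)) =>
        G (q.1.1, q.2, q.1.2)) (hG.comp (by fun_prop))
  unfold P
  rw [lintegral_prod_symm _ (by fun_prop), lintegral_prod_symm _ (by
    exact (hm.comp (f := fun ω : Ω₁ × Ω₂ => (M.exo t ω.1, M.endo t ω.2))
      (by fun_prop)).aemeasurable)]
  refine lintegral_congr fun ω₂ => ?_
  have hG' : Measurable fun q : ExoHist M.dimXi t × Vec (M.dimXi (t + 1)) =>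
      G (q.1, q.2, M.endo t ω₂) := hG.comp (by fun_prop)
  calc ∫⁻ ω₁, G (M.exo t ω₁, M.ξ (t + 1) ω₁, M.endo t ω₂) ∂M.P₁
      = ∫⁻ q, G (q.1, q.2, M.endo t ω₂) ∂M.P₁.map (fun ω => (M.exo t ω, M.ξ (t + 1) ω)) :=
        (lintegral_map hG' (hx.prodMk hξ)).symm
    _ = ∫⁻ h, ∫⁻ y, G (h, y, M.endo t ω₂) ∂M.condLaw t h ∂M.lawExo t := by
        rw [M.map_exo_ξ ht, Measure.lintegral_compProd hG']
    _ = _ := lintegral_map hG'.lintegral_kernel_prod_right' hx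

/-- First `ζ_t` is integrated out with `ξ_{t+1}` kept as part of the exogenous data, then `ξ_{t+1}`.
-/
theorem lintegral_ξ_ζ {t : ℕ} (ht : t + 1 ≤ M.T)
    {Φ : (ExoHist M.dimXi t × EndoHist M.dimZ t) × (Vec (M.dimXi (t + 1)) × Vec (M.dimZ t)) →
      ℝ≥0∞} (hΦ : Measurable Φ) :
    ∫⁻ ω, Φ ((M.exo t ω.1, M.endo t ω.2), (M.ξ (t + 1) ω.1, M.ζ t ω.2)) ∂M.P =
      ∫⁻ ω, ∫⁻ p, Φ ((M.exo t ω.1, M.endo t ω.2), p)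
        ∂(M.condLaw t (M.exo t ω.1)).prod (M.lawZ t) ∂M.P := by
  have hx := M.measurable_exo (t := t) (by omega)
  have hξ := M.measurable_ξ (t + 1) (by omega) ht
  rw [M.lintegral_ζ (t := t) (by omega) (hx.prodMk hξ)
    (Φ := fun q => Φ ((q.1.1, q.2.1), (q.1.2, q.2.2))) (hΦ.comp (by fun_prop)),
    M.lintegral_ξ ht (G := fun q => ∫⁻ z, Φ ((q.1, q.2.2), (q.2.1, z)) ∂M.lawZ t)
      (Measurable.lintegral_prod_right' (f := fun q : (ExoHist M.dimXi t ×
        Vec (M.dimXi (t + 1)) × EndoHist M.dimZ t) × Vec (M.dimZ t) =>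
          Φ ((q.1.1, q.1.2.2), (q.1.2.1, q.2))) (hΦ.comp (by fun_prop)))]
  refine lintegral_congr fun ω => ?_
  exact (lintegral_prod (fun p => Φ ((M.exo t ω.1, M.endo t ω.2), p))
    (hΦ.comp measurable_prodMk_left).aemeasurable).symm

/-! ### Adapted processes -/

/-- A random element that is a measurable function of `(ξ_[t], ζ₀, …, ζ_{t-1})`. -/
def Adapted {U : Type*} [MeasurableSpace U] (t : ℕ) (u : Ω₁ × Ω₂ → U) : Prop :=
  ∃ f : ExoHist M.dimXi t × EndoHist M.dimZ t → U, Measurable f ∧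
    ∀ ω, u ω = f (M.exo t ω.1, M.endo t ω.2)

variable {M}

theorem Adapted.measurable {U : Type*} [MeasurableSpace U] {t : ℕ} {u : Ω₁ × Ω₂ → U}
    (h : M.Adapted t u) (ht : t ≤ M.T) : Measurable u := by
  obtain ⟨f, hf, hu⟩ := h
  rw [funext hu]
  have := M.measurable_exo ht
  have := M.measurable_endo (t := t) (by omega)
  fun_prop

theorem Adapted.comp {U V : Type*} [MeasurableSpace U] [MeasurableSpace V] {t : ℕ}
    {u : Ω₁ × Ω₂ → U} (h : M.Adapted t u) {φ : U → V} (hφ : Measurable φ) :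
    M.Adapted t fun ω => φ (u ω) := by
  obtain ⟨f, hf, hu⟩ := h
  exact ⟨fun q => φ (f q), hφ.comp hf, fun ω => congrArg φ (hu ω)⟩

theorem Adapted.prodMk {U V : Type*} [MeasurableSpace U] [MeasurableSpace V] {t : ℕ}
    {u : Ω₁ × Ω₂ → U} {v : Ω₁ × Ω₂ → V} (hu : M.Adapted t u) (hv : M.Adapted t v) :
    M.Adapted t fun ω => (u ω, v ω) := by
  obtain ⟨f, hf, hu⟩ := hu
  obtain ⟨g, hg, hv⟩ := hv
  exact ⟨fun q => (f q, g q), hf.prodMk hg, fun ω => Prod.ext (hu ω) (hv ω)⟩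

theorem Adapted.succ {U : Type*} [MeasurableSpace U] {t : ℕ} {u : Ω₁ × Ω₂ → U}
    (h : M.Adapted t u) : M.Adapted (t + 1) u := by
  obtain ⟨f, hf, hu⟩ := h
  refine ⟨fun q => f (Fin.init q.1, fun i => q.2 i.castSucc), hf.comp (Measurable.prodMk
    ((measurable_init t).comp measurable_fst) ?_), fun ω => hu ω⟩
  exact measurable_pi_lambda _ fun i => (measurable_pi_apply i.castSucc).comp measurable_snd

theorem adapted_exo (t : ℕ) : M.Adapted t fun ω => M.exo t ω.1 :=
  ⟨Prod.fst, measurable_fst, fun _ => rfl⟩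

theorem adapted_ζ (t : ℕ) : M.Adapted (t + 1) fun ω => M.ζ t ω.2 :=
  ⟨fun q => q.2 (Fin.last t), (measurable_pi_apply (Fin.last t)).comp measurable_snd, fun _ => rfl⟩

theorem adapted_state_succ (hCont : M.ContinuousData) {x : M.Decision} {t : ℕ} (ht : t < M.T)
    (h : M.Adapted t fun ω => (M.state x t ω, x t ω)) :
    M.Adapted (t + 1) (M.state x (t + 1)) :=
  Adapted.comp (M := M) ((h.prodMk (adapted_exo t)).succ.prodMk (adapted_ζ t))
    (((M.continuous_step hCont ht).comp (f := fun q : ((Vec (M.dimS t) × Vec (M.dimX t)) ×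
      ExoHist M.dimXi t) × Vec (M.dimZ t) => (q.1.1.1, q.1.1.2, q.1.2, q.2))
      (by fun_prop)).measurable)

/-- Adaptedness is the only consequence of implementability that the cost estimates use, so both
policy classes are treated together from here on. -/
theorem adapted_of_implementable (hCont : M.ContinuousData) {c : PolicyClass} {x : M.Decision}
    (hx : M.Implementable c x) {x₀ : Vec (M.dimX 0)} (hx₀ : ∀ ω, x 0 ω = x₀) {t : ℕ}
    (ht : t ≤ M.T) : M.Adapted t fun ω => (M.state x t ω, x t ω) := by
  induction t with
  | zero => exact ⟨fun _ => (M.s₀, x₀), measurable_const, fun ω => Prod.ext rfl (hx₀ ω)⟩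
  | succ t ih =>
    have hs := adapted_state_succ hCont ht (ih (by omega))
    refine hs.prodMk ?_
    cases c with
    | feedback =>
      obtain ⟨π, hπ, he⟩ := hx t ht
      have h1 : M.Adapted (t + 1) (x t) := ((ih (by omega)).comp measurable_snd).succ
      have h2 := (hs.prodMk (h1.prodMk (adapted_exo (t + 1)))).comp hπ
      obtain ⟨f, hf, hf'⟩ := h2
      exact ⟨f, hf, fun ω => (he ω).trans (hf' ω)⟩
    | history =>
      obtain ⟨π, hπ, he⟩ := hx t ht
      exact ⟨π, hπ, he⟩

/-- The states and decisions generated by a feedback law. -/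
def feedbackPath (x₀ : Vec (M.dimX 0))
    (π : (t : ℕ) → Vec (M.dimS (t + 1)) × Vec (M.dimX t) × ExoHist M.dimXi (t + 1) →
      Vec (M.dimX (t + 1))) : (t : ℕ) → Ω₁ × Ω₂ → Vec (M.dimS t) × Vec (M.dimX t)
  | 0, _ => (M.s₀, x₀)
  | t + 1, ω =>
      (M.step t (feedbackPath x₀ π t ω).1 (feedbackPath x₀ π t ω).2 (M.exo t ω.1) (M.ζ t ω.2),
        π t (M.step t (feedbackPath x₀ π t ω).1 (feedbackPath x₀ π t ω).2 (M.exo t ω.1)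
          (M.ζ t ω.2), (feedbackPath x₀ π t ω).2, M.exo (t + 1) ω.1))

/-- A feedback policy is adapted, hence also history-dependent, so one feedback law serves both
classes. -/
theorem exists_implementable (hCont : M.ContinuousData) (c : PolicyClass) (x₀ : Vec (M.dimX 0))
    (π : (t : ℕ) → Vec (M.dimS (t + 1)) × Vec (M.dimX t) × ExoHist M.dimXi (t + 1) →
      Vec (M.dimX (t + 1))) (hπ : ∀ t, t < M.T → Measurable (π t)) :
    ∃ x : M.Decision, M.Implementable c x ∧ (∀ ω, x 0 ω = x₀) ∧
      ∀ t ω, x (t + 1) ω = π t (M.state x (t + 1) ω, x t ω, M.exo (t + 1) ω.1) := by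
  -- States and decisions were built jointly; this identifies the first component with the state
  -- process of the second.
  have hst : ∀ t ω, M.state (fun t ω => (feedbackPath x₀ π t ω).2) t ω =
      (feedbackPath x₀ π t ω).1 := by
    intro t ω
    induction t with
    | zero => rfl
    | succ t ih => simp only [state, feedbackPath, ih]
  have hpath : ∀ t ω, (feedbackPath x₀ π (t + 1) ω).2 =
      π t (M.state (fun t ω => (feedbackPath x₀ π t ω).2) (t + 1) ω,
        (feedbackPath x₀ π t ω).2, M.exo (t + 1) ω.1) := by
    intro t ω
    rw [hst]
    rfl
  have hfb : M.Implementable .feedback fun t ω => (feedbackPath x₀ π t ω).2 :=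
    fun t ht => ⟨π t, hπ t ht, hpath t⟩
  refine ⟨fun t ω => (feedbackPath x₀ π t ω).2, ?_, fun _ => rfl, hpath⟩
  cases c with
  | feedback => exact hfb
  | history =>
    intro t ht
    exact (adapted_of_implementable hCont hfb (x₀ := x₀) (fun _ => rfl) ht).comp measurable_snd

end Model
end MSPMDP

namespace MSPMDP
namespace Model
namespace Envelope

variable {Ω₁ Ω₂ : Type*} [MeasurableSpace Ω₁] [MeasurableSpace Ω₂] {M : Model Ω₁ Ω₂}
  (E : M.Envelope)

/-! ### Expected costs along a policy -/

/-- The shifted cost of stage `t` along a policy. -/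
noncomputable def pathCost (x : M.Decision) (t : ℕ) (ω : Ω₁ × Ω₂) : ℝ≥0∞ :=
  E.shiftedCost t (M.state x t ω, x t ω) (M.exo t ω.1, M.ζ t ω.2)

/-- The shifted objective of stage `t` along a policy. -/
noncomputable def pathObj (k : ℕ) (x : M.Decision) (t : ℕ) (ω : Ω₁ × Ω₂) : ℝ≥0∞ :=
  E.obj k t (M.state x t ω, x t ω) (M.exo t ω.1)

/-- The shifted value of the stages from `t + 1` on, along a policy. -/
noncomputable def pathVal (k : ℕ) (x : M.Decision) (t : ℕ) (ω : Ω₁ × Ω₂) : ℝ≥0∞ :=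
  E.val k t (M.state x (t + 1) ω, x t ω) (M.exo (t + 1) ω.1)

variable {x : M.Decision}

theorem measurable_pathCost (hCont : M.ContinuousData) {t : ℕ} (h1 : 1 ≤ t) (ht : t ≤ M.T)
    (hx : M.Adapted t fun ω => (M.state x t ω, x t ω)) : Measurable (E.pathCost x t) := by
  have h2 := (E.measurable_shiftedCost hCont h1 ht).comp
    ((hx.measurable ht).prodMk (M.measurable_exo_ζ ht))
  exact h2

theorem measurable_pathObj (hCont : M.ContinuousData) {k t : ℕ} (h1 : 1 ≤ t) (ht : t + k = M.T)
    (hx : M.Adapted t fun ω => (M.state x t ω, x t ω)) : Measurable (E.pathObj k x t) := by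
  have h2 := (E.normalIntegrand_obj hCont k t h1 ht).measurable.comp
    ((hx.measurable (by omega)).prodMk ((M.measurable_exo (by omega)).comp measurable_fst))
  exact h2

theorem lintegral_pathObj_zero (hCont : M.ContinuousData) {t : ℕ} (h1 : 1 ≤ t) (ht : t ≤ M.T)
    (hx : M.Adapted t fun ω => (M.state x t ω, x t ω)) :
    ∫⁻ ω, E.pathObj 0 x t ω ∂M.P = ∫⁻ ω, E.pathCost x t ω ∂M.P := by
  obtain ⟨f, hf, hfx⟩ := hx
  have hm : Measurable fun q : ExoHist M.dimXi t × EndoHist M.dimZ t × Vec (M.dimZ t) =>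
      E.shiftedCost t (f (q.1, q.2.1)) (q.1, q.2.2) :=
    (E.measurable_shiftedCost hCont h1 ht).comp (f := fun q : ExoHist M.dimXi t ×
      EndoHist M.dimZ t × Vec (M.dimZ t) => (f (q.1, q.2.1), (q.1, q.2.2))) (by fun_prop)
  have key := M.lintegral_ζ ht (M.measurable_exo ht) hm
  simp only [pathObj, pathCost, obj]
  simp only [← hfx] at key
  exact key.symm

/-- One step of dynamic programming in expectation: as `(s_t, x_t)` is determined by the past, the
integral defining `obj` is the conditional expectation of stage cost plus later value. -/
theorem lintegral_pathObj_succ (hCont : M.ContinuousData) {k t : ℕ} (h1 : 1 ≤ t)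
    (ht : t + 1 + k = M.T) (hx : M.Adapted t fun ω => (M.state x t ω, x t ω)) :
    ∫⁻ ω, E.pathObj (k + 1) x t ω ∂M.P =
      ∫⁻ ω, E.pathCost x t ω ∂M.P + ∫⁻ ω, E.pathVal k x t ω ∂M.P := by
  rw [← lintegral_add_left (E.measurable_pathCost hCont h1 (by omega) hx)]
  obtain ⟨f, hf, hfx⟩ := hx
  have hm1 : Measurable fun q : (ExoHist M.dimXi t × EndoHist M.dimZ t) ×
      (Vec (M.dimXi (t + 1)) × Vec (M.dimZ t)) => E.shiftedCost t (f q.1) (q.1.1, q.2.2) :=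
    (E.measurable_shiftedCost hCont h1 (by omega)).comp (f := fun q : (ExoHist M.dimXi t ×
      EndoHist M.dimZ t) × (Vec (M.dimXi (t + 1)) × Vec (M.dimZ t)) =>
        (f q.1, (q.1.1, q.2.2))) (by fun_prop)
  have hm2 := (E.measurable_val_step hCont ht).comp (f := fun q : (ExoHist M.dimXi t ×
      EndoHist M.dimZ t) × (Vec (M.dimXi (t + 1)) × Vec (M.dimZ t)) =>
        (f q.1, q.1.1, q.2)) (by fun_prop)
  have key := M.lintegral_ξ_ζ (by omega) (hm1.add hm2)
  simp only [Pi.add_apply, Function.comp_apply, ← hfx, ← M.exo_succ] at key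
  exact key.symm

variable (x) in
/-- Decisions that attain the value of the stagewise problems along almost every outcome. -/
def AttainsStages : Prop :=
  ∀ k t, t + 1 + k = M.T → E.pathVal k x t =ᵐ[M.P] E.pathObj k x (t + 1)

/-- Telescoping: bound the value by the objective, split off one stage cost, and repeat. -/
theorem lintegral_pathVal_le (hCont : M.ContinuousData)
    (hx : ∀ t, t ≤ M.T → M.Adapted t fun ω => (M.state x t ω, x t ω))
    (hle : ∀ k t, t + 1 + k = M.T → E.pathVal k x t ≤ᵐ[M.P] E.pathObj k x (t + 1)) (k t : ℕ)
    (ht : t + 1 + k = M.T) :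
    ∫⁻ ω, E.pathVal k x t ω ∂M.P ≤
      ∑ i ∈ Finset.range (k + 1), ∫⁻ ω, E.pathCost x (t + 1 + i) ω ∂M.P := by
  induction k generalizing t with
  | zero =>
    simp only [zero_add, Finset.sum_range_one, add_zero]
    rw [← E.lintegral_pathObj_zero hCont (by omega) (by omega) (hx (t + 1) (by omega))]
    exact lintegral_mono_ae (hle 0 t ht)
  | succ k ih =>
    refine (lintegral_mono_ae (hle (k + 1) t ht)).trans ?_
    rw [E.lintegral_pathObj_succ hCont (by omega) (by omega) (hx (t + 1) (by omega)),
      Finset.sum_range_succ', add_comm]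
    refine add_le_add ((ih (t + 1) (by omega)).trans (le_of_eq ?_)) le_rfl
    refine Finset.sum_congr rfl fun i _ => ?_
    rw [show t + 1 + 1 + i = t + 1 + (i + 1) by ring]

theorem lintegral_pathVal_eq (hCont : M.ContinuousData)
    (hx : ∀ t, t ≤ M.T → M.Adapted t fun ω => (M.state x t ω, x t ω))
    (hatt : E.AttainsStages x) (k t : ℕ) (ht : t + 1 + k = M.T) :
    ∫⁻ ω, E.pathVal k x t ω ∂M.P =
      ∑ i ∈ Finset.range (k + 1), ∫⁻ ω, E.pathCost x (t + 1 + i) ω ∂M.P := by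
  induction k generalizing t with
  | zero =>
    simp only [zero_add, Finset.sum_range_one, add_zero]
    rw [← E.lintegral_pathObj_zero hCont (by omega) (by omega) (hx (t + 1) (by omega))]
    exact lintegral_congr_ae (hatt 0 t ht)
  | succ k ih =>
    rw [lintegral_congr_ae (hatt (k + 1) t ht),
      E.lintegral_pathObj_succ hCont (by omega) (by omega) (hx (t + 1) (by omega)),
      Finset.sum_range_succ', add_comm, ih (t + 1) (by omega)]
    congr 1
    refine Finset.sum_congr rfl fun i _ => ?_
    rw [show t + 1 + 1 + i = t + 1 + (i + 1) by ring]

/-- A function below another with the same finite integral equals it almost everywhere. Finiteness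
also allows the stage cost to be cancelled, so the hypothesis passes to the next stage. -/
theorem ae_eq_of_lintegral_pathVal_eq (hCont : M.ContinuousData)
    (hx : ∀ t, t ≤ M.T → M.Adapted t fun ω => (M.state x t ω, x t ω))
    (hle : ∀ k t, t + 1 + k = M.T → E.pathVal k x t ≤ᵐ[M.P] E.pathObj k x (t + 1)) (k t : ℕ)
    (ht : t + 1 + k = M.T) (hfin : ∫⁻ ω, E.pathVal k x t ω ∂M.P ≠ ⊤)
    (heq : ∑ i ∈ Finset.range (k + 1), ∫⁻ ω, E.pathCost x (t + 1 + i) ω ∂M.P ≤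
      ∫⁻ ω, E.pathVal k x t ω ∂M.P) :
    ∀ j ≤ k, ∀ s, s + 1 + j = M.T → E.pathVal j x s =ᵐ[M.P] E.pathObj j x (s + 1) := by
  have hmeas := E.measurable_pathObj hCont (by omega : 1 ≤ t + 1) ht (hx (t + 1) (by omega))
  induction k generalizing t with
  | zero =>
    intro j hj s hs
    obtain rfl : j = 0 := by omega
    obtain rfl : s = t := by omega
    simp only [zero_add, Finset.sum_range_one, add_zero] at heq
    rw [← E.lintegral_pathObj_zero hCont (by omega) (by omega) (hx (s + 1) (by omega))] at heq
    exact ae_eq_of_ae_le_of_lintegral_le (hle 0 s hs) hfin hmeas.aemeasurable heq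
  | succ k ih =>
    have h2 := E.lintegral_pathVal_le hCont hx hle k (t + 1) (by omega)
    have hsum : ∑ i ∈ Finset.range (k + 1 + 1), ∫⁻ ω, E.pathCost x (t + 1 + i) ω ∂M.P =
        ∫⁻ ω, E.pathCost x (t + 1) ω ∂M.P +
          ∑ i ∈ Finset.range (k + 1), ∫⁻ ω, E.pathCost x (t + 1 + 1 + i) ω ∂M.P := by
      rw [Finset.sum_range_succ', add_comm]
      congr 1
      refine Finset.sum_congr rfl fun i _ => ?_
      rw [show t + 1 + 1 + i = t + 1 + (i + 1) by ring]
    have hobj := E.lintegral_pathObj_succ hCont (by omega : 1 ≤ t + 1) (by omega)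
      (hx (t + 1) (by omega)) (k := k)
    rw [hsum] at heq
    have hobjle : ∫⁻ ω, E.pathObj (k + 1) x (t + 1) ω ∂M.P ≤
        ∫⁻ ω, E.pathVal (k + 1) x t ω ∂M.P := by
      rw [hobj]
      exact (add_le_add le_rfl h2).trans heq
    have hobjfin := ne_top_of_le_ne_top hfin hobjle
    have hvle := lintegral_mono_ae (hle (k + 1) t ht)
    rw [hobj] at hobjfin hvle
    -- The finite expected cost of stage `t + 1` is cancelled on both sides.
    have hnext : ∑ i ∈ Finset.range (k + 1), ∫⁻ ω, E.pathCost x (t + 1 + 1 + i) ω ∂M.P ≤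
        ∫⁻ ω, E.pathVal k x (t + 1) ω ∂M.P :=
      (ENNReal.add_le_add_iff_left (ENNReal.add_ne_top.1 hobjfin).1).1 (heq.trans hvle)
    intro j hj s hs
    rcases Nat.lt_or_ge k j with hkj | hkj
    · obtain rfl : j = k + 1 := by omega
      obtain rfl : s = t := by omega
      exact ae_eq_of_ae_le_of_lintegral_le (hle _ s hs) hfin hmeas.aemeasurable hobjle
    · exact ih (t + 1) (by omega) (ENNReal.add_ne_top.1 hobjfin).2 hnext
        (E.measurable_pathObj hCont (by omega) (by omega) (hx (t + 1 + 1) (by omega))) j hkj s hs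

/-! ### The cost of a policy and the objective of the initial stage -/

/-- The expected sum of the lower bounds of all stages. -/
noncomputable def totalBound : ℝ≥0∞ :=
  ∑ t ∈ Finset.range (M.T + 1), ∫⁻ p, E.B t p ∂(M.lawExo t).prod (M.lawZ t)

theorem totalBound_ne_top : E.totalBound ≠ ⊤ :=
  ENNReal.sum_ne_top.2 fun t ht => E.lintegral_B_ne_top t (by rw [Finset.mem_range] at ht; omega)

theorem measurable_shiftedCost_zero (hInit : M.InitialCost) {x : Vec (M.dimX 0)}
    (hx : x ∈ M.X₀) : Measurable fun z => E.shiftedCost 0 (M.s₀, x) (M.hist₀, z) :=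
  ENNReal.measurable_ofReal.comp ((hInit.meas x hx).add
    ((E.measurable_B 0).coe_nnreal_real.comp measurable_prodMk_left))

theorem pathCost_zero_eq {x₀ : Vec (M.dimX 0)} (h : ∀ ω, x 0 ω = x₀) :
    E.pathCost x 0 = fun ω => E.shiftedCost 0 (M.s₀, x₀) (M.hist₀, M.ζ 0 ω.2) := by
  funext ω
  simp only [pathCost, h, state]
  rw [Subsingleton.elim (M.exo 0 ω.1) M.hist₀]

theorem measurable_pathCost_zero (hInit : M.InitialCost) {x₀ : Vec (M.dimX 0)} (hx₀ : x₀ ∈ M.X₀)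
    (h : ∀ ω, x 0 ω = x₀) : Measurable (E.pathCost x 0) := by
  rw [E.pathCost_zero_eq h]
  exact (E.measurable_shiftedCost_zero hInit hx₀).comp
    ((M.measurable_ζ 0 (by omega)).comp measurable_snd)

theorem ae_cost_nonneg {x₀ : Vec (M.dimX 0)} (hx₀ : x₀ ∈ M.X₀) (h : ∀ ω, x 0 ω = x₀) {t : ℕ}
    (ht : t ≤ M.T) : ∀ᵐ ω ∂M.P,
      0 ≤ M.C t (M.state x t ω) (x t ω) (M.exo t ω.1) (M.ζ t ω.2) +
        E.B t (M.exo t ω.1, M.ζ t ω.2) := by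
  rcases Nat.eq_zero_or_pos t with rfl | hpos
  · have h1 := ae_of_ae_map (M.measurable_ζ 0 (by omega)).aemeasurable E.lower_zero
    have h2 : ∀ᵐ ω ∂M.P, ∀ x ∈ M.X₀,
        0 ≤ M.C 0 M.s₀ x M.hist₀ (M.ζ 0 ω.2) + E.B 0 (M.hist₀, M.ζ 0 ω.2) :=
      Measure.quasiMeasurePreserving_snd.ae h1
    filter_upwards [h2] with ω hω
    rw [h, Subsingleton.elim (M.exo 0 ω.1) M.hist₀]
    exact hω x₀ hx₀
  · have h1 := E.lower t hpos ht
    rw [← M.map_exo_ζ ht] at h1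
    filter_upwards [ae_of_ae_map (M.measurable_exo_ζ ht).aemeasurable h1] with ω hω
    exact hω _ _

/-- Decisions do not influence `(ξ_[t], ζ_t)`, so the expected shift is the same constant for every
policy and costs can be compared through nonnegative integrals. -/
theorem cost_eq (hInit : M.InitialCost) (hCont : M.ContinuousData) {x₀ : Vec (M.dimX 0)}
    (hx₀ : x₀ ∈ M.X₀) (h : ∀ ω, x 0 ω = x₀)
    (hx : ∀ t, t ≤ M.T → M.Adapted t fun ω => (M.state x t ω, x t ω)) :
    QuasiIntegrable M.P (fun ω => ((M.totalCost x ω : ℝ) : EReal)) ∧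
    M.cost x = ((∑ t ∈ Finset.range (M.T + 1), ∫⁻ ω, E.pathCost x t ω ∂M.P : ℝ≥0∞) : EReal) -
      (E.totalBound : EReal) := by
  have hlt : ∀ {t}, t ∈ Finset.range (M.T + 1) → t ≤ M.T := fun ht => by
    rw [Finset.mem_range] at ht; omega
  have hB : ∀ t ∈ Finset.range (M.T + 1),
      Measurable fun ω : Ω₁ × Ω₂ => (E.B t (M.exo t ω.1, M.ζ t ω.2) : ℝ≥0∞) := fun t ht =>
    (E.measurable_B t).coe_nnreal_ennreal.comp (M.measurable_exo_ζ (hlt ht))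
  have hC : ∀ t ∈ Finset.range (M.T + 1), Measurable (E.pathCost x t) := fun t ht => by
    rcases Nat.eq_zero_or_pos t with rfl | hpos
    · exact E.measurable_pathCost_zero hInit hx₀ h
    · exact E.measurable_pathCost hCont hpos (hlt ht) (hx t (hlt ht))
  have hBi : ∫⁻ ω, ∑ t ∈ Finset.range (M.T + 1), (E.B t (M.exo t ω.1, M.ζ t ω.2) : ℝ≥0∞) ∂M.P =
      E.totalBound := by
    rw [lintegral_finsetSum _ hB]
    refine Finset.sum_congr rfl fun t ht => ?_
    rw [← M.map_exo_ζ (hlt ht), lintegral_map (E.measurable_B t).coe_nnreal_ennreal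
      (M.measurable_exo_ζ (hlt ht))]
  have hnn : ∀ᵐ ω ∂M.P, ∀ t ∈ Finset.range (M.T + 1),
      0 ≤ M.C t (M.state x t ω) (x t ω) (M.exo t ω.1) (M.ζ t ω.2) +
        E.B t (M.exo t ω.1, M.ζ t ω.2) :=
    (ae_ball_iff (Finset.countable_toSet _)).2 fun t ht => E.ae_cost_nonneg hx₀ h (hlt ht)
  have := expect_of_ae_eq_sub (μ := M.P) (f := fun ω => ((M.totalCost x ω : ℝ) : EReal))
    (F := fun ω => ∑ t ∈ Finset.range (M.T + 1), E.pathCost x t ω)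
    (H := fun ω => ∑ t ∈ Finset.range (M.T + 1), (E.B t (M.exo t ω.1, M.ζ t ω.2) : ℝ≥0∞))
    (Finset.measurable_fun_sum _ hC).aemeasurable (Finset.measurable_fun_sum _ hB).aemeasurable
    (by rw [hBi]; exact E.totalBound_ne_top) ?_
  · rw [hBi, lintegral_finsetSum _ hC] at this
    exact this
  · filter_upwards [hnn] with ω hω
    have hsum : M.totalCost x ω +
        ((∑ t ∈ Finset.range (M.T + 1), E.B t (M.exo t ω.1, M.ζ t ω.2) : ℝ≥0) : ℝ) =
        ∑ t ∈ Finset.range (M.T + 1),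
          (M.C t (M.state x t ω) (x t ω) (M.exo t ω.1) (M.ζ t ω.2) +
            E.B t (M.exo t ω.1, M.ζ t ω.2)) := by
      rw [Finset.sum_add_distrib, NNReal.coe_sum]
      rfl
    rw [coe_eq_ofReal_sub (b := ∑ t ∈ Finset.range (M.T + 1), E.B t (M.exo t ω.1, M.ζ t ω.2))
      (by rw [hsum]; exact Finset.sum_nonneg hω), hsum, ENNReal.ofReal_sum_of_nonneg hω,
      ENNReal.ofNNReal_finsetSum]
    rfl

/-- The shifted objective of the initial stage. -/
noncomputable def initVal (x : Vec (M.dimX 0)) : ℝ≥0∞ :=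
  ∫⁻ z, (E.shiftedCost 0 (M.s₀, x) (M.hist₀, z) +
    ∫⁻ y, E.val (M.T - 1) 0 (M.step 0 M.s₀ x M.hist₀ z, x) y ∂M.lawExo 1) ∂M.lawZ 0

theorem measurable_val_zero (hCont : M.ContinuousData) (x : Vec (M.dimX 0)) :
    Measurable fun q : Vec (M.dimZ 0) × ExoHist M.dimXi 1 =>
      E.val (M.T - 1) 0 (M.step 0 M.s₀ x M.hist₀ q.1, x) q.2 := by
  have hT := M.one_le_T
  have h1 : Measurable fun q : Vec (M.dimZ 0) × ExoHist M.dimXi 1 =>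
      ((M.step 0 M.s₀ x M.hist₀ q.1, x), q.2) := by
    refine Measurable.prodMk (Measurable.prodMk ?_ measurable_const) measurable_snd
    exact ((M.continuous_step hCont hT).comp (f := fun q : Vec (M.dimZ 0) × ExoHist M.dimXi 1 =>
      (M.s₀, x, M.hist₀, q.1)) (by fun_prop)).measurable
  have h2 := (E.normalIntegrand_val hCont (M.T - 1) 0 (by omega)).measurable.comp h1
  exact h2

theorem init_inner_eq (hInt : M.IntegrableCosts) (hCont : M.ContinuousData)
    (x : Vec (M.dimX 0)) (z : Vec (M.dimZ 0)) :
    QuasiIntegrable (M.lawExo 1) (fun y => M.value 0 M.s₀ x y z) ∧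
    expect (M.lawExo 1) (fun y => M.value 0 M.s₀ x y z) =
      ((∫⁻ y, E.val (M.T - 1) 0 (M.step 0 M.s₀ x M.hist₀ z, x) y ∂M.lawExo 1 : ℝ≥0∞) : EReal) -
        ((∫⁻ y, E.slack (M.T - 1) 1 y ∂M.lawExo 1 : ℝ≥0∞) : EReal) := by
  have hT := M.one_le_T
  refine expect_of_ae_eq_sub
    ((E.measurable_val_zero hCont x).comp measurable_prodMk_left).aemeasurable
    (E.measurable_slack _ _).aemeasurable (E.lintegral_slack_ne_top (M.T - 1) 1 (by omega)) ?_
  filter_upwards [E.ae_regular hInt hCont (M.T - 1) 0 (by omega)] with y hy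
  rw [M.value_eq_tail hT, Subsingleton.elim (Fin.init y) M.hist₀]
  exact hy.tail_eq _ _

/-- The recursion and the policy costs are shifted by the same total constant. -/
theorem lintegral_B_zero_add_slack :
    ∫⁻ z, ((E.B 0 (M.hist₀, z) : ℝ≥0∞) + ∫⁻ y, E.slack (M.T - 1) 1 y ∂M.lawExo 1) ∂M.lawZ 0 =
      E.totalBound := by
  have hT := M.one_le_T
  have := M.isProbabilityMeasure_lawZ (t := 0) (by omega)
  have := M.isProbabilityMeasure_lawExo (t := 0) (by omega)
  rw [lintegral_add_right _ measurable_const, lintegral_const, measure_univ, mul_one,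
    E.lintegral_slack _ _ (by omega), totalBound, Finset.sum_range_succ' _ M.T, add_comm]
  congr 1
  · rw [show M.T - 1 + 1 = M.T by omega]
    refine Finset.sum_congr rfl fun i _ => ?_
    rw [add_comm 1 i]
  · rw [← E.lintegral_lintegral_B 0]
    have : ∀ h : ExoHist M.dimXi 0, ∫⁻ z, (E.B 0 (h, z) : ℝ≥0∞) ∂M.lawZ 0 =
        ∫⁻ z, (E.B 0 (M.hist₀, z) : ℝ≥0∞) ∂M.lawZ 0 := fun h => by
      rw [Subsingleton.elim h M.hist₀]
    rw [lintegral_congr this, lintegral_const, measure_univ, mul_one]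

theorem initObj_eq (hInt : M.IntegrableCosts) (hInit : M.InitialCost) (hCont : M.ContinuousData)
    {x : Vec (M.dimX 0)} (hx : x ∈ M.X₀) :
    QuasiIntegrable (M.lawZ 0) (fun z => ((M.C 0 M.s₀ x M.hist₀ z : ℝ) : EReal) +
      expect (M.lawExo 1) fun y => M.value 0 M.s₀ x y z) ∧
    M.initObj x = (E.initVal x : EReal) - (E.totalBound : EReal) := by
  have hBm : Measurable fun z => (E.B 0 (M.hist₀, z) : ℝ≥0∞) :=
    (E.measurable_B 0).coe_nnreal_ennreal.comp measurable_prodMk_left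
  rw [← E.lintegral_B_zero_add_slack]
  refine expect_of_ae_eq_sub ((E.measurable_shiftedCost_zero hInit hx).add
    (E.measurable_val_zero hCont x).lintegral_prod_right').aemeasurable
    (hBm.add measurable_const).aemeasurable
    (by rw [E.lintegral_B_zero_add_slack]; exact E.totalBound_ne_top) ?_
  filter_upwards [E.lower_zero] with z hz
  rw [(E.init_inner_eq hInt hCont x z).2, E.coe_cost_eq (p := (M.hist₀, z)) (hz x hx),
    EReal_sub_add_sub]

/-- Since `ζ₀` and `ξ₁` live on different factors, Tonelli turns the iterated integral into one over
the product space. -/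
theorem initVal_eq (hInit : M.InitialCost) (hCont : M.ContinuousData) {x₀ : Vec (M.dimX 0)}
    (hx₀ : x₀ ∈ M.X₀) (h : ∀ ω, x 0 ω = x₀) :
    E.initVal x₀ = ∫⁻ ω, E.pathCost x 0 ω ∂M.P + ∫⁻ ω, E.pathVal (M.T - 1) x 0 ω ∂M.P := by
  have hT := M.one_le_T
  have hv := E.measurable_val_zero hCont x₀
  have hc := E.measurable_shiftedCost_zero hInit hx₀
  have hz := M.measurable_ζ 0 (by omega)
  have hexo := M.measurable_exo (t := 1) hT
  rw [initVal, lintegral_add_left hc]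
  congr 1
  · rw [E.pathCost_zero_eq h, lawZ, lintegral_map hc hz, P]
    refine Eq.symm ((lintegral_prod _ ((hc.comp (hz.comp measurable_snd)).aemeasurable)).trans ?_)
    simp
  · have h2 : E.pathVal (M.T - 1) x 0 = fun ω =>
        E.val (M.T - 1) 0 (M.step 0 M.s₀ x₀ M.hist₀ (M.ζ 0 ω.2), x₀) (M.exo 1 ω.1) := by
      funext ω
      simp only [pathVal, h, state]
      rw [Subsingleton.elim (M.exo 0 ω.1) M.hist₀]
    have h3 : Measurable fun ω : Ω₁ × Ω₂ =>
        E.val (M.T - 1) 0 (M.step 0 M.s₀ x₀ M.hist₀ (M.ζ 0 ω.2), x₀) (M.exo 1 ω.1) :=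
      hv.comp (f := fun ω : Ω₁ × Ω₂ => (M.ζ 0 ω.2, M.exo 1 ω.1)) (by fun_prop)
    rw [h2, P, lintegral_prod_symm _ h3.aemeasurable, lawZ,
      lintegral_map hv.lintegral_prod_right' hz]
    refine lintegral_congr fun ω₂ => ?_
    exact lintegral_map (hv.comp measurable_prodMk_left) hexo

end Envelope
end Model
end MSPMDP

namespace MSPMDP
namespace Model
namespace Envelope

variable {Ω₁ Ω₂ : Type*} [MeasurableSpace Ω₁] [MeasurableSpace Ω₂] {M : Model Ω₁ Ω₂}
  (E : M.Envelope) {x : M.Decision}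

/-! ### Comparison of policies -/

theorem pathVal_ae_le (hInt : M.IntegrableCosts) (hCont : M.ContinuousData) {c : PolicyClass}
    (hx : M.Feasible c x) (k t : ℕ) (ht : t + 1 + k = M.T) :
    E.pathVal k x t ≤ᵐ[M.P] E.pathObj k x (t + 1) := by
  filter_upwards [hx.2.2 t (by omega),
    M.ae_exo (by omega) (E.ae_regular hInt hCont k t ht)] with ω h1 h2
  exact h2.val_le _ _ _ h1

theorem attainsStages_iff (hInt : M.IntegrableCosts) (hCont : M.ContinuousData) :
    E.AttainsStages x ↔ ∀ t, t < M.T → ∀ᵐ ω ∂M.P,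
      M.stageObj (t + 1) (M.state x (t + 1) ω) (x (t + 1) ω) (M.exo (t + 1) ω.1) =
        M.value t (M.state x t ω) (x t ω) (M.exo (t + 1) ω.1) (M.ζ t ω.2) := by
  have key : ∀ k t, t + 1 + k = M.T → ∀ᵐ ω ∂M.P,
      (E.pathVal k x t ω = E.pathObj k x (t + 1) ω ↔
      M.stageObj (t + 1) (M.state x (t + 1) ω) (x (t + 1) ω) (M.exo (t + 1) ω.1) =
        M.value t (M.state x t ω) (x t ω) (M.exo (t + 1) ω.1) (M.ζ t ω.2)) := by
    intro k t ht
    filter_upwards [M.ae_exo (by omega) (E.ae_regular hInt hCont k t ht)] with ω h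
    rw [M.value_eq_tail (by omega), h.tail_eq, h.stageObj_eq, EReal_sub_right_inj h.slack_ne_top]
    exact eq_comm
  constructor
  · intro h t ht
    filter_upwards [key (M.T - (t + 1)) t (by omega), h (M.T - (t + 1)) t (by omega)] with ω h1 h2
    exact h1.1 h2
  · intro h k t ht
    filter_upwards [key k t ht, h t (by omega)] with ω h1 h2
    exact h1.2 h2

theorem sum_pathCost (x : M.Decision) :
    ∑ t ∈ Finset.range (M.T + 1), ∫⁻ ω, E.pathCost x t ω ∂M.P =
      ∫⁻ ω, E.pathCost x 0 ω ∂M.P +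
        ∑ i ∈ Finset.range (M.T - 1 + 1), ∫⁻ ω, E.pathCost x (0 + 1 + i) ω ∂M.P := by
  have hT := M.one_le_T
  rw [Finset.sum_range_succ', add_comm, show M.T - 1 + 1 = M.T by omega]
  congr 1
  refine Finset.sum_congr rfl fun i _ => ?_
  rw [show 0 + 1 + i = i + 1 by ring]

variable {x₀ : Vec (M.dimX 0)} {c : PolicyClass}

theorem initObj_le_cost (E : M.Envelope) (hInt : M.IntegrableCosts)
    (hInit : M.InitialCost) (hCont : M.ContinuousData)
    (hx : M.Feasible c x) (hx₀ : x₀ ∈ M.X₀) (h : ∀ ω, x 0 ω = x₀) :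
    M.initObj x₀ ≤ M.cost x := by
  have hT := M.one_le_T
  have hA := fun t (ht : t ≤ M.T) => adapted_of_implementable hCont hx.2.1 h ht
  rw [(E.initObj_eq hInt hInit hCont hx₀).2, (E.cost_eq hInit hCont hx₀ h hA).2,
    EReal_sub_le_sub_right_iff E.totalBound_ne_top, E.initVal_eq hInit hCont hx₀ h, E.sum_pathCost]
  exact add_le_add le_rfl (E.lintegral_pathVal_le hCont hA
    (fun k t ht => E.pathVal_ae_le hInt hCont hx k t ht) (M.T - 1) 0 (by omega))

theorem cost_eq_initObj (E : M.Envelope) (hInt : M.IntegrableCosts)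
    (hInit : M.InitialCost) (hCont : M.ContinuousData)
    (hx : M.Feasible c x) (hx₀ : x₀ ∈ M.X₀) (h : ∀ ω, x 0 ω = x₀)
    (hatt : E.AttainsStages x) : M.cost x = M.initObj x₀ := by
  have hT := M.one_le_T
  have hA := fun t (ht : t ≤ M.T) => adapted_of_implementable hCont hx.2.1 h ht
  rw [(E.initObj_eq hInt hInit hCont hx₀).2, (E.cost_eq hInit hCont hx₀ h hA).2,
    E.initVal_eq hInit hCont hx₀ h, E.sum_pathCost,
    E.lintegral_pathVal_eq hCont hA hatt (M.T - 1) 0 (by omega)]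

/-- Finiteness of the initial objective makes the shifted stage `0` cost cancellable and the
expected later value finite, which starts the descent through the stages. -/
theorem attainsStages_of_cost_le (hInt : M.IntegrableCosts) (hInit : M.InitialCost)
    (hCont : M.ContinuousData)
    (hx : M.Feasible c x) (hx₀ : x₀ ∈ M.X₀) (h : ∀ ω, x 0 ω = x₀)
    (hle : M.cost x ≤ M.initObj x₀) (hfin : M.initObj x₀ < ⊤) : E.AttainsStages x := by
  have hT := M.one_le_T
  have hA := fun t (ht : t ≤ M.T) => adapted_of_implementable hCont hx.2.1 h ht
  rw [(E.initObj_eq hInt hInit hCont hx₀).2] at hle hfin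
  rw [EReal_sub_lt_top_iff E.totalBound_ne_top, E.initVal_eq hInit hCont hx₀ h] at hfin
  rw [(E.cost_eq hInit hCont hx₀ h hA).2, EReal_sub_le_sub_right_iff E.totalBound_ne_top,
    E.initVal_eq hInit hCont hx₀ h, E.sum_pathCost,
    ENNReal.add_le_add_iff_left (ENNReal.add_ne_top.1 hfin).1] at hle
  intro k t ht
  exact E.ae_eq_of_lintegral_pathVal_eq hCont hA
    (fun k t ht => E.pathVal_ae_le hInt hCont hx k t ht) (M.T - 1) 0 (by omega)
    (ENNReal.add_ne_top.1 hfin).2 hle k (by omega) t ht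

/-- Every admissible initial decision extends to a policy that solves the later stages. -/
theorem exists_feasible_attainsStages (hInt : M.IntegrableCosts)
    (hCont : M.ContinuousData) (c : PolicyClass) (hx₀ : x₀ ∈ M.X₀) :
    ∃ x, M.Feasible c x ∧ (∀ ω, x 0 ω = x₀) ∧ E.AttainsStages x := by
  have hπ : ∀ t, ∃ π : Vec (M.dimS (t + 1)) × Vec (M.dimX t) × ExoHist M.dimXi (t + 1) →
      Vec (M.dimX (t + 1)), t < M.T → Measurable π ∧
        ∀ k, t + 1 + k = M.T → ∀ᵐ h ∂M.lawExo (t + 1), ∀ s x,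
          π (s, x, h) ∈ M.feas t s x h ∧
            E.obj k (t + 1) (s, π (s, x, h)) h = E.val k t (s, x) h := by
    intro t
    by_cases ht : t < M.T
    · obtain ⟨π, h1, h2⟩ := E.exists_measurable_decision hInt hCont (M.T - (t + 1)) t (by omega)
      refine ⟨π, fun _ => ⟨h1, fun k hk => ?_⟩⟩
      obtain rfl : k = M.T - (t + 1) := by omega
      exact h2
    · exact ⟨fun _ => 0, fun h => absurd h ht⟩
  choose π hπ using hπ
  obtain ⟨x, hx, h0, hstep⟩ := exists_implementable hCont c x₀ π fun t ht => (hπ t ht).1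
  refine ⟨x, ⟨⟨x₀, hx₀, h0⟩, hx, fun t ht => ?_⟩, h0, fun k t ht => ?_⟩
  · filter_upwards [M.ae_exo (by omega) ((hπ t ht).2 (M.T - (t + 1)) (by omega))] with ω hω
    rw [hstep]
    exact (hω _ _).1
  · filter_upwards [M.ae_exo (by omega) ((hπ t (by omega)).2 k ht)] with ω hω
    simp only [pathVal, pathObj]
    rw [hstep]
    exact (hω _ _).2.symm

/-! ### Equality of the values and characterization of optimal policies -/

theorem optValue_eq (E : M.Envelope) (hInt : M.IntegrableCosts)
    (hInit : M.InitialCost) (hCont : M.ContinuousData)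
    (c : PolicyClass) : M.optValue c = M.v₀ := by
  refine le_antisymm (le_iInf₂ fun x₀ hx₀ => ?_) (le_iInf₂ fun x hx => ?_)
  · obtain ⟨x, hx, h0, hatt⟩ := E.exists_feasible_attainsStages hInt hCont c hx₀
    rw [← E.cost_eq_initObj hInt hInit hCont hx hx₀ h0 hatt]
    exact iInf₂_le x hx
  · obtain ⟨x₀, hx₀, h0⟩ := hx.1
    exact (iInf₂_le x₀ hx₀).trans (E.initObj_le_cost hInt hInit hCont hx hx₀ h0)

theorem isOptimal_of_initObj_eq (hInt : M.IntegrableCosts) (hInit : M.InitialCost)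
    (hCont : M.ContinuousData)
    (hx : M.Feasible c x) (hx₀ : x₀ ∈ M.X₀) (h : ∀ ω, x 0 ω = x₀)
    (hv : M.initObj x₀ = M.v₀) (hatt : E.AttainsStages x) : M.IsOptimal c x := by
  refine ⟨hx, fun y hy => ?_⟩
  rw [E.cost_eq_initObj hInt hInit hCont hx hx₀ h hatt, hv,
    ← E.optValue_eq hInt hInit hCont c]
  exact iInf₂_le y hy

/-- The chain `v₀ ≤ initObj x₀ ≤ cost x ≤ v₀` collapses to equalities. -/
theorem stagewiseOptimal_of_isOptimal (E : M.Envelope) (hInt : M.IntegrableCosts)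
    (hInit : M.InitialCost) (hCont : M.ContinuousData)
    (hv : M.v₀ < ⊤) (hx : M.IsOptimal c x) :
    M.StagewiseOptimal x := by
  obtain ⟨x₀, hx₀, h0⟩ := hx.1.1
  have h1 : M.cost x ≤ M.v₀ := by
    rw [← E.optValue_eq hInt hInit hCont c]
    exact le_iInf₂ hx.2
  have h2 := E.initObj_le_cost hInt hInit hCont hx.1 hx₀ h0
  have h3 : M.v₀ ≤ M.initObj x₀ := iInf₂_le x₀ hx₀
  have h4 : M.initObj x₀ = M.v₀ := le_antisymm (h2.trans h1) h3
  exact ⟨fun ω => by rw [h0, h4], (E.attainsStages_iff hInt hCont).1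
    (E.attainsStages_of_cost_le hInt hInit hCont hx.1 hx₀ h0 (h1.trans h3) (by rwa [h4]))⟩

/-! ### Existence of an optimal initial decision -/

theorem normalIntegrand_val_zero (hCont : M.ContinuousData) :
    NormalIntegrand fun (x : M.X₀) (q : Vec (M.dimZ 0) × ExoHist M.dimXi 1) =>
      E.val (M.T - 1) 0 (M.step 0 M.s₀ x M.hist₀ q.1, x) q.2 := by
  have hT := M.one_le_T
  have h1 : ∀ q : Vec (M.dimZ 0) × ExoHist M.dimXi 1, Continuous fun x : M.X₀ =>
      (M.step 0 M.s₀ x M.hist₀ q.1, (x : Vec (M.dimX 0))) := fun q =>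
    ((M.continuous_step hCont hT).comp (f := fun x : M.X₀ =>
      (M.s₀, (x : Vec (M.dimX 0)), M.hist₀, q.1)) (by fun_prop)).prodMk continuous_subtype_val
  have h2 : ∀ x : M.X₀, Measurable fun q : Vec (M.dimZ 0) × ExoHist M.dimXi 1 =>
      (M.step 0 M.s₀ x M.hist₀ q.1, (x : Vec (M.dimX 0))) := fun x =>
    ((M.continuous_step hCont hT).comp (f := fun q : Vec (M.dimZ 0) × ExoHist M.dimXi 1 =>
      (M.s₀, (x : Vec (M.dimX 0)), M.hist₀, q.1)) (by fun_prop)).measurable.prodMk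
      measurable_const
  have h3 := (E.normalIntegrand_val hCont (M.T - 1) 0 (by omega)).comp h1 h2 measurable_snd
  exact h3

/-- The initial cost is regular only on `X₀`, so normal integrands are taken over that subtype. -/
theorem lowerSemicontinuous_initVal (hInit : M.InitialCost) (hCont : M.ContinuousData)
    (hC : ∀ z, ContinuousOn (fun x => M.C 0 M.s₀ x M.hist₀ z) M.X₀) :
    LowerSemicontinuous fun x : M.X₀ => E.initVal x := by
  have h1 : NormalIntegrand fun (x : M.X₀) (z : Vec (M.dimZ 0)) =>
      E.shiftedCost 0 (M.s₀, (x : Vec (M.dimX 0))) (M.hist₀, z) := by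
    refine .of_continuous_measurable (fun z => ?_) fun x =>
      E.measurable_shiftedCost_zero hInit x.2
    exact ENNReal.continuous_ofReal.comp
      ((continuousOn_iff_continuous_domRestrict.1 (hC z)).add continuous_const)
  have h2 := (E.normalIntegrand_val_zero hCont).lintegral (Kernel.const _ (M.lawExo 1))
  -- A dummy `Unit` parameter makes integration against the fixed law of `ζ₀` an instance of kernel
  -- integration.
  have h3 := (h1.add h2).comp (φ := fun (x : M.X₀) (_ : Unit × Vec (M.dimZ 0)) => x)
    (ψ := Prod.snd) (fun _ => continuous_id) (fun _ => measurable_const) measurable_snd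
  have h4 := (h3.lintegral (Kernel.const _ (M.lawZ 0))).lowerSemicontinuous ()
  simp only [Kernel.const_apply] at h4
  exact h4

theorem exists_initObj_eq_v₀ (E : M.Envelope) (hInt : M.IntegrableCosts) (hInit : M.InitialCost)
    (hCont : M.ContinuousData) (hK : IsCompact M.X₀) (hne : M.X₀.Nonempty)
    (hC : ∀ z, ContinuousOn (fun x => M.C 0 M.s₀ x M.hist₀ z) M.X₀) :
    ∃ x₀ ∈ M.X₀, M.initObj x₀ = M.v₀ := by
  have hlsc := E.lowerSemicontinuous_initVal hInit hCont hC
  have : CompactSpace M.X₀ := isCompact_iff_compactSpace.1 hK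
  obtain ⟨x₀, -, hmin⟩ := LowerSemicontinuousOn.exists_isMinOn (s := Set.univ)
    ⟨⟨hne.some, hne.some_mem⟩, Set.mem_univ _⟩ isCompact_univ (hlsc.lowerSemicontinuousOn _)
  have hle : ∀ x ∈ M.X₀, M.initObj x₀ ≤ M.initObj x := fun x hx => by
    rw [(E.initObj_eq hInt hInit hCont x₀.2).2, (E.initObj_eq hInt hInit hCont hx).2,
      EReal_sub_le_sub_right_iff E.totalBound_ne_top]
    exact isMinOn_iff.1 hmin ⟨x, hx⟩ (Set.mem_univ _)
  exact ⟨x₀, x₀.2, le_antisymm (le_iInf₂ hle) (iInf₂_le x₀.1 x₀.2)⟩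

theorem wellPosed (E : M.Envelope) (hInt : M.IntegrableCosts)
    (hInit : M.InitialCost) (hCont : M.ContinuousData)
    (c : PolicyClass) : M.WellPosed c where
  policy x hx := by
    obtain ⟨x₀, hx₀, h0⟩ := hx.1
    exact (E.cost_eq hInit hCont hx₀ h0
      fun t ht => adapted_of_implementable hCont hx.2.1 h0 ht).1
  init_inner x _ z := (E.init_inner_eq hInt hCont x z).1
  init_outer x hx := (E.initObj_eq hInt hInit hCont hx).1
  middle t h1 ht := by
    filter_upwards [E.ae_bellmanObj_eq hCont h1 (k := M.T - (t + 1)) (by omega)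
      ((E.ae_regular hInt hCont _ t (by omega)).mono fun h hh => hh.tail_eq)] with h hh s x
    exact (hh s x).1
  last := by
    filter_upwards [E.ae_lastObj_eq hCont M.one_le_T rfl] with h hh s x
    exact (hh s x).1

end Envelope
end Model
end MSPMDP

theorem mainTheorem1 {Ω₁ Ω₂ : Type*} [MeasurableSpace Ω₁] [MeasurableSpace Ω₂]
    (M : MSPMDP.Model Ω₁ Ω₂)
    (hInt : M.IntegrableCosts) (hInit : M.InitialCost)
    (hCont : M.ContinuousData) (hBdd : M.BoundedFeasibleSets)
    (c : MSPMDP.PolicyClass) :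
    -- all expectations are well defined
    M.WellPosed c ∧
    -- the problem over policies, the nested problem and the recursion have the same value
    M.optValue c = M.nestedValue ∧ M.nestedValue = M.v₀ ∧
    -- the minima of the stages `1, …, T` are attained
    (∀ t, t < M.T → ∀ᵐ h ∂M.lawExo (t + 1), ∀ s x z,
      ∃ x' ∈ M.feas t (M.step t s x (Fin.init h) z) x h,
        M.stageObj (t + 1) (M.step t s x (Fin.init h) z) x' h = M.value t s x h z) ∧
    -- stagewise optimal policies are optimal, and conversely if the value is finite
    (∀ x, M.Feasible c x → M.StagewiseOptimal x → M.IsOptimal c x) ∧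
    (M.v₀ < ⊤ → ∀ x, M.IsOptimal c x → M.StagewiseOptimal x) ∧
    -- every solution of the initial problem extends to an optimal policy
    (∀ x₀ ∈ M.X₀, M.initObj x₀ = M.v₀ → ∃ x, M.IsOptimal c x ∧ ∀ ω, x 0 ω = x₀) ∧
    -- an optimal policy exists if the initial problem is continuous on a nonempty compact set
    (IsCompact M.X₀ → M.X₀.Nonempty →
      (∀ z, ContinuousOn (fun x => M.C 0 M.s₀ x M.hist₀ z) M.X₀) →
      ∃ x, M.IsOptimal c x) := by
  obtain ⟨E⟩ := M.exists_envelope hInt hInit hBdd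
  have hext : ∀ x₀ ∈ M.X₀, M.initObj x₀ = M.v₀ → ∃ x, M.IsOptimal c x ∧ ∀ ω, x 0 ω = x₀ := by
    intro x₀ hx₀ hv
    obtain ⟨x, hx, h0, hatt⟩ := E.exists_feasible_attainsStages hInt hCont c hx₀
    exact ⟨x, E.isOptimal_of_initObj_eq hInt hInit hCont hx hx₀ h0 hv hatt, h0⟩
  refine ⟨E.wellPosed hInt hInit hCont c,
    (E.optValue_eq hInt hInit hCont c).trans M.nestedValue_eq_v₀.symm, M.nestedValue_eq_v₀,
    fun t ht => ?_, fun x hx hst => ?_,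
    fun hv x hx => E.stagewiseOptimal_of_isOptimal hInt hInit hCont hv hx, hext,
    fun hK hne hC => ?_⟩
  · filter_upwards [E.ae_regular hInt hCont (M.T - (t + 1)) t (by omega)] with h hh s x z
    obtain ⟨x', hx', he⟩ := hh.exists_minimizer (M.step t s x (Fin.init h) z) x
    refine ⟨x', hx', ?_⟩
    rw [M.value_eq_tail ht, hh.stageObj_eq, hh.tail_eq, he]
  · obtain ⟨x₀, hx₀, h0⟩ := hx.1
    -- The condition on `x 0` is stated outcome by outcome, so an outcome is needed to extract it.
    have hω : Nonempty (Ω₁ × Ω₂) := nonempty_of_isProbabilityMeasure M.P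
    exact E.isOptimal_of_initObj_eq hInt hInit hCont hx hx₀ h0
      (by rw [← h0 hω.some]; exact hst.1 _) ((E.attainsStages_iff hInt hCont).2 hst.2)
  · obtain ⟨x₀, hx₀, hv⟩ := E.exists_initObj_eq_v₀ hInt hInit hCont hK hne hC
    obtain ⟨x, hx, -⟩ := hext x₀ hx₀ hv
    exact ⟨x, hx⟩
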